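/- All alphabets are finite. A (multi-valued partial) function $f$ assigns to every $x\in\Sigma^*$ a set $f(x)\subseteq\Gamma^*$; it is single-valued if $|f(x)|\le 1$ for all $x$, and total if $f(x)\neq\emptyset$ for all $x$. An npda with output tape is a one-way nondeterministic pushdown automaton (finitely many states and stack symbols, finitely many choices per move, $\lambda$-moves allowed) which reads its input $x$ between endmarkers, as $\cent x\dollar$, which in each move writes at most one symbol on a write-only output tape, which halts exactly on entering an accepting or a rejecting state, and all of whose computation paths on inputs of length $n$ reach a halting state within $O(n)$ steps. It computes the function $f$ for which $f(x)$ is the set of strings on the output tape at the end of the accepting computation paths on $x$. Let $\mathrm{CFLMV}$ be the class of functions computed in this way. An oracle npda with oracle $A\subseteq\Delta^*$ has in addition a write-only query tape over $\Delta$, on which each move writes at most one symbol, and three special states $q_{query},q_{yes},q_{no}$: whenever it enters $q_{query}$, with the string $s$ on the query tape, the query tape is erased, and the next state is $q_{yes}$ if $s\in A$ and $q_{no}$ otherwise. All its computation paths on inputs of length $n$ must reach a halting state within $O(n)$ steps, no matter what oracle is used. Let $\mathrm{CFL}_T^A$ be the class of languages accepted by oracle npda's (without output tape) with oracle $A$,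 and let $\mathrm{CFLMV}_T^A$ be the class of functions computed by oracle npda's with an output tape and oracle $A$; for a class $\mathcal C$ of languages put $\mathrm{CFL}_T(\mathcal C)=\bigcup_{A\in\mathcal C}\mathrm{CFL}_T^A$ and $\mathrm{CFLMV}_T(\mathcal C)=\bigcup_{A\in\mathcal C}\mathrm{CFLMV}_T^A$. Let $\Sigma_1^{\mathrm{CFL}}$ be the class of context-free languages and, for $k\ge 1$, let $\Pi_k^{\mathrm{CFL}}$ be the class of complements of languages in $\Sigma_k^{\mathrm{CFL}}$, and $\Sigma_{k+1}^{\mathrm{CFL}}=\mathrm{CFL}_T(\Pi_k^{\mathrm{CFL}})$. Let $\Sigma_1^{\mathrm{CFL}}\mathrm{MV}=\mathrm{CFLMV}$ and $\Sigma_{k+1}^{\mathrm{CFL}}\mathrm{MV}=\mathrm{CFLMV}_T(\Pi_k^{\mathrm{CFL}})$ for $k\ge1$, and let $\Sigma_k^{\mathrm{CFL}}\mathrm{SV}_t$ be the class of single-valued total functions in $\Sigma_k^{\mathrm{CFL}}\mathrm{MV}$. Then, for every $k\ge 1$ and every $f\in\Sigma_k^{\mathrm{CFL}}\mathrm{SV}_t$,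 there is a deterministic multi-tape Turing machine that on every input $x$ halts with the unique element of $f(x)$ as its output, and that on every input of length $n$ scans $O(n)$ tape cells. -/

import Mathlib

/-! ### Generalities on computations -/

/-- `ReachesIn r t c d`: there is a computation path of exactly `t` steps from `c` to `d`. -/
inductive ReachesIn {C : Type*} (r : C → C → Prop) : ℕ → C → C → Prop
  | refl (c : C) : ReachesIn r 0 c c
  | tail {t : ℕ} {c d e : C} : ReachesIn r t c d → r d e → ReachesIn r (t + 1) c e

/-- Every computation path from `c` reaches a halting configuration within `T` steps: no path is
longer than `T`, and a path can only stop in a halting configuration. -/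
def TerminatesWithin {C : Type*} (r : C → C → Prop) (halting : C → Prop) (c : C) (T : ℕ) : Prop :=
  ∀ t d, ReachesIn r t c d → t ≤ T ∧ ((∀ e, ¬ r d e) → halting d)

/-- Symbols on the input tape of a pushdown automaton: letters and the two endmarkers. -/
inductive InputSym (α : Type) : Type
  | cent : InputSym α
  | letter (a : α) : InputSym α
  | dollar : InputSym α

/-- The content `¢ x $` of the input tape on input `x`. -/
def inputTape {α : Type} (x : List α) : List (InputSym α) :=
  InputSym.cent :: (x.map InputSym.letter ++ [InputSym.dollar])

/-! ### Pushdown automata with an output tape -/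

/-- One-way nondeterministic pushdown automata over the input alphabet `α`. A move is determined by
the state, by the scanned input symbol (`some s`) or a `λ`-move (`none`), and by the topmost stack
symbol; it gives a new state, a string replacing the topmost stack symbol (its first letter becomes
the new top), and an element of `W` saying what is written on the write-only tapes.
For a single write-only tape with alphabet `γ`, `W = Option γ`. -/
structure NPDA (α W : Type) where
  /-- inner states -/
  Q : Type
  /-- stack alphabet -/
  Θ : Type
  finite_Q : Finite Q
  finite_Θ : Finite Θ
  /-- transition function -/
  δ : Q → Option (InputSym α) → Θ → Set (Q × List Θ × W)
  finite_δ : ∀ q s Z, (δ q s Z).Finite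
  /-- initial state -/
  q₀ : Q
  /-- bottom marker -/
  Z₀ : Θ
  /-- accepting states -/
  acc : Set Q
  /-- rejecting states -/
  rej : Set Q
  disjoint_acc_rej : Disjoint acc rej

namespace NPDA

variable {α γ W : Type}

/-- The halting states. -/
def halt (N : NPDA α W) : Set N.Q := N.acc ∪ N.rej

/-- Configurations of an npda with an output tape. `input` is the part of the input tape that is
not yet read, the head of `stack` is its top. -/
structure Config (N : NPDA α (Option γ)) where
  state : N.Q
  input : List (InputSym α)
  stack : List N.Θ
  output : List γ

/-- The initial configuration on input `x`. -/
def start (N : NPDA α (Option γ)) (x : List α) : N.Config :=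
  ⟨N.q₀, inputTape x, [N.Z₀], []⟩

/-- One move of an npda with an output tape. -/
inductive Step (N : NPDA α (Option γ)) : N.Config → N.Config → Prop
  | read {q p : N.Q} {s : InputSym α} {u : List (InputSym α)} {Z : N.Θ} {v st : List N.Θ}
      {o : Option γ} {out : List γ} :
      q ∉ N.halt → (p, v, o) ∈ N.δ q (some s) Z →
      Step N ⟨q, s :: u, Z :: st, out⟩ ⟨p, u, v ++ st, out ++ o.toList⟩
  | lambda {q p : N.Q} {u : List (InputSym α)} {Z : N.Θ} {v st : List N.Θ}
      {o : Option γ} {out : List γ} :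
      q ∉ N.halt → (p, v, o) ∈ N.δ q none Z →
      Step N ⟨q, u, Z :: st, out⟩ ⟨p, u, v ++ st, out ++ o.toList⟩

/-- The termination condition: on inputs of length `n`, all computation paths reach halting states
in `O(n)` steps. -/
def LinearTime (N : NPDA α (Option γ)) : Prop :=
  ∃ a b : ℕ, ∀ x : List α,
    TerminatesWithin N.Step (fun c => c.state ∈ N.halt) (N.start x) (a * x.length + b)

/-- The set of valid outcomes on input `x`: those produced along accepting computation paths. -/
def outcomes (N : NPDA α (Option γ)) (x : List α) : Set (List γ) :=
  {y | ∃ c : N.Config, Relation.ReflTransGen N.Step (N.start x) c ∧ c.state ∈ N.acc ∧ c.output = y}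

end NPDA

/-! ### Oracle pushdown automata -/

/-- Oracle npda's with input alphabet `α`, query alphabet `β` and output alphabet `γ`: npda's with
two write-only tapes (output tape and query tape) and three special inner states. -/
structure OracleNPDA (α β γ : Type) extends NPDA α (Option γ × Option β) where
  query : Q
  yes : Q
  no : Q
  query_not_halt : query ∉ acc ∪ rej
  query_ne_yes : query ≠ yes
  query_ne_no : query ≠ no
  yes_ne_no : yes ≠ no

namespace OracleNPDA

variable {α β γ : Type}

/-- Configurations of an oracle npda; `queryTape` is the content of the query tape. -/
structure Config (M : OracleNPDA α β γ) where
  state : M.Q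
  input : List (InputSym α)
  stack : List M.Θ
  output : List γ
  queryTape : List β

/-- The initial configuration on input `x`. -/
def start (M : OracleNPDA α β γ) (x : List α) : M.Config :=
  ⟨M.q₀, inputTape x, [M.Z₀], [], []⟩

/-- One move of an oracle npda with oracle `A`. In the query state the content of the query tape is
sent to the oracle, the query tape is erased, and the state becomes `yes` or `no` according to the
answer. -/
inductive Step (M : OracleNPDA α β γ) (A : Language β) : M.Config → M.Config → Prop
  | read {q p : M.Q} {s : InputSym α} {u : List (InputSym α)} {Z : M.Θ} {v st : List M.Θ}
      {o : Option γ} {r : Option β} {out : List γ} {qt : List β} :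
      q ∉ M.halt → q ≠ M.query → (p, v, o, r) ∈ M.δ q (some s) Z →
      Step M A ⟨q, s :: u, Z :: st, out, qt⟩ ⟨p, u, v ++ st, out ++ o.toList, qt ++ r.toList⟩
  | lambda {q p : M.Q} {u : List (InputSym α)} {Z : M.Θ} {v st : List M.Θ}
      {o : Option γ} {r : Option β} {out : List γ} {qt : List β} :
      q ∉ M.halt → q ≠ M.query → (p, v, o, r) ∈ M.δ q none Z →
      Step M A ⟨q, u, Z :: st, out, qt⟩ ⟨p, u, v ++ st, out ++ o.toList, qt ++ r.toList⟩
  | answerYes {u : List (InputSym α)} {st : List M.Θ} {out : List γ} {qt : List β} :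
      qt ∈ A → Step M A ⟨M.query, u, st, out, qt⟩ ⟨M.yes, u, st, out, []⟩
  | answerNo {u : List (InputSym α)} {st : List M.Θ} {out : List γ} {qt : List β} :
      qt ∉ A → Step M A ⟨M.query, u, st, out, qt⟩ ⟨M.no, u, st, out, []⟩

/-- The termination condition: no matter what oracle is used, all computation paths on inputs of
length `n` reach halting states in `O(n)` steps. -/
def LinearTime (M : OracleNPDA α β γ) : Prop :=
  ∃ a b : ℕ, ∀ (B : Language β) (x : List α),
    TerminatesWithin (M.Step B) (fun c => c.state ∈ M.halt) (M.start x) (a * x.length + b)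

/-- The set of valid outcomes on input `x` with oracle `A`. -/
def outcomes (M : OracleNPDA α β γ) (A : Language β) (x : List α) : Set (List γ) :=
  {y | ∃ c : M.Config,
    Relation.ReflTransGen (M.Step A) (M.start x) c ∧ c.state ∈ M.acc ∧ c.output = y}

/-- `M` with oracle `A` accepts `x`: some computation path is accepting. -/
def Accepts (M : OracleNPDA α β γ) (A : Language β) (x : List α) : Prop :=
  ∃ c : M.Config, Relation.ReflTransGen (M.Step A) (M.start x) c ∧ c.state ∈ M.acc

end OracleNPDA

/-! ### The CFL hierarchy and the CFL function hierarchy -/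

/-- `CFL_T^A`: languages over `α` that are Turing reducible to `A` by oracle npda's. There is no
output tape, that is, the output alphabet is empty. -/
def CFLT {α β : Type} (A : Language β) : Set (Language α) :=
  {L | ∃ M : OracleNPDA α β Empty, M.LinearTime ∧ ∀ x, x ∈ L ↔ M.Accepts A x}

/-- The classes `Σ_k^CFL` (`k ≥ 1`) of languages over `α`: `Σ_1^CFL = CFL` and
`Σ_{k+1}^CFL = CFL_T(Π_k^CFL)`, where `A ∈ Π_k^CFL` iff the complement of `A` is in `Σ_k^CFL`.
The value at `0` is not used. -/
def SigmaCFL : ℕ → (α : Type) → Set (Language α)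
  | 0, _ => ∅
  | 1, _ => {L | L.IsContextFree}
  | k + 2, _ => {L | ∃ (β : Type) (_ : Finite β) (A : Language β),
      Aᶜ ∈ SigmaCFL (k + 1) β ∧ L ∈ CFLT A}

/-- `Π_k^CFL = co-Σ_k^CFL`. -/
def PiCFL (k : ℕ) (α : Type) : Set (Language α) := {A | Aᶜ ∈ SigmaCFL k α}

/-- `CFLMV`: multi-valued partial functions computed by npda's with output tapes. -/
def CFLMV (α γ : Type) : Set (List α → Set (List γ)) :=
  {f | ∃ N : NPDA α (Option γ), N.LinearTime ∧ ∀ x, f x = N.outcomes x}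

/-- `CFLMV_T^A`: functions computed by oracle npda's with oracle `A`. -/
def CFLMVT {α β γ : Type} (A : Language β) : Set (List α → Set (List γ)) :=
  {f | ∃ M : OracleNPDA α β γ, M.LinearTime ∧ ∀ x, f x = M.outcomes A x}

/-- `Σ_k^CFL MV` (`k ≥ 1`): `Σ_1^CFL MV = CFLMV` and `Σ_{k+1}^CFL MV = CFLMV_T(Π_k^CFL)`.
The value at `0` is not used. -/
def SigmaCFLMV : ℕ → (α γ : Type) → Set (List α → Set (List γ))
  | 0, _, _ => ∅
  | 1, α, γ => CFLMV α γ
  | k + 2, _, _ => {f | ∃ (β : Type) (_ : Finite β), ∃ A ∈ PiCFL (k + 1) β, f ∈ CFLMVT A}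

/-- `Σ_k^CFL SV`: the single-valued partial functions in `Σ_k^CFL MV`. -/
def SigmaCFLSV (k : ℕ) (α γ : Type) : Set (List α → Set (List γ)) :=
  {f | f ∈ SigmaCFLMV k α γ ∧ ∀ x, (f x).Subsingleton}

/-- `Σ_k^CFL SV_t`: the total functions in `Σ_k^CFL SV`. -/
def SigmaCFLSVt (k : ℕ) (α γ : Type) : Set (List α → Set (List γ)) :=
  {f | f ∈ SigmaCFLSV k α γ ∧ ∀ x, (f x).Nonempty}

/-! ### Deterministic multi-tape Turing machines -/

/-- Moves of a tape head. -/
inductive HeadMove : Type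
  | left : HeadMove
  | stay : HeadMove
  | right : HeadMove

/-- The displacement of a head move. -/
def HeadMove.shift : HeadMove → ℤ
  | left => -1
  | stay => 0
  | right => 1

/-- The two-way infinite tape with `w` in the cells `0, …, |w| - 1` and blanks elsewhere. -/
def wordTape {S : Type} (blank : S) (w : List S) : ℤ → S
  | Int.ofNat n => w.getD n blank
  | Int.negSucc _ => blank

/-- Deterministic multi-tape Turing machines with input alphabet `α` and output alphabet `γ`, both
identified with sets of nonblank tape symbols. The tapes are indexed by a finite type `ι` and are
two-way infinite; `δ q s = none` means that the machine halts. -/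
structure MultiTapeTM (α γ : Type) where
  /-- states -/
  Q : Type
  /-- tapes -/
  ι : Type
  /-- tape symbols -/
  S : Type
  finite_Q : Finite Q
  finite_ι : Finite ι
  finite_S : Finite S
  blank : S
  inSym : α → S
  inSym_injective : Function.Injective inSym
  inSym_ne_blank : ∀ a, inSym a ≠ blank
  outSym : γ → S
  outSym_injective : Function.Injective outSym
  outSym_ne_blank : ∀ a, outSym a ≠ blank
  inTape : ι
  outTape : ι
  q₀ : Q
  /-- transition function: new state, and symbol written and head move for every tape -/
  δ : Q → (ι → S) → Option (Q × (ι → S × HeadMove))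

namespace MultiTapeTM

variable {α γ : Type}

/-- Configurations: state, tape contents and head positions. -/
structure Config (M : MultiTapeTM α γ) where
  state : M.Q
  cells : M.ι → ℤ → M.S
  head : M.ι → ℤ

open Classical in
/-- The initial configuration: the input is on the input tape, all other tapes are blank, and all
heads are in cell `0`. -/
noncomputable def start (M : MultiTapeTM α γ) (x : List α) : M.Config where
  state := M.q₀
  cells i := if i = M.inTape then wordTape M.blank (x.map M.inSym) else fun _ => M.blank
  head _ := 0

/-- The next configuration, or `none` if the machine halts. -/
def step (M : MultiTapeTM α γ) (c : M.Config) : Option M.Config :=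
  (M.δ c.state fun i => c.cells i (c.head i)).map fun r =>
    { state := r.1
      cells := fun i => Function.update (c.cells i) (c.head i) (r.2 i).1
      head := fun i => c.head i + (r.2 i).2.shift }

/-- `c` occurs in the computation on input `x`. -/
def Reaches (M : MultiTapeTM α γ) (x : List α) (c : M.Config) : Prop :=
  Relation.ReflTransGen (fun c d => M.step c = some d) (M.start x) c

/-- On input `x` the machine halts, and then the output tape contains `y` and nothing else. -/
def Outputs (M : MultiTapeTM α γ) (x : List α) (y : List γ) : Prop :=
  ∃ c, M.Reaches x c ∧ M.step c = none ∧ c.cells M.outTape = wordTape M.blank (y.map M.outSym)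

/-- The cells of tape `i` that are scanned in the computation on input `x`. -/
def scanned (M : MultiTapeTM α γ) (x : List α) (i : M.ι) : Set ℤ :=
  {p | ∃ c, M.Reaches x c ∧ c.head i = p}

/-- The machine is `O(n)` space-bounded: on every input of length `n` it scans `O(n)` cells of each
of its tapes, input and output tape included. -/
def LinearSpace (M : MultiTapeTM α γ) : Prop :=
  ∃ a b : ℕ, ∀ (x : List α) (i : M.ι), (M.scanned x i).encard ≤ ((a * x.length + b : ℕ) : ℕ∞)

/-- The machine computes the single-valued total function `f`: on every input `x` it halts with the
unique value of `f` at `x` as its output. -/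
def Computes (M : MultiTapeTM α γ) (f : List α → Set (List γ)) : Prop :=
  ∀ x, ∃ y, f x = {y} ∧ M.Outputs x y

end MultiTapeTM

/-! ### Programs working on several stacks -/

/-! Everything rests on one exhaustive search that fits into linear space. If an oracle npda is
followed for at most `T = a * n + b` steps, a computation path is described by `T` choices from a
finite set, its stack, output tape and query tape have length `O(T)`, and every query has length at
most `T`. If the oracle itself is decided in linear space, a deterministic procedure can replay the
path for one list of choices, clean up, and pass to the next list, counting through the lists as
through numbers in base `m + 1`. The memory is reused for all paths and all queries, so exponential
time still needs only linear space. This is `Search.exists_stackProg`.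

By induction on the level, every language in `Σ_k^CFL` is then decided in linear space
(`decidesInLinearSpace_of_mem_sigmaCFL`); complements are harmless because the procedure is
deterministic and halts. For a function, the search stops at the first accepting path: by totality
there is one, and by single-valuedness its output is the value (`exists_multiTapeTM_of_oracleNPDA`).

The lowest level needs its own argument, since its languages are given by grammars, and the
automaton that follows leftmost derivations need not halt. By `ContextFreeGrammar.exists_short_gen`,
a derivable word of length `n` has a derivation of `O(n)` steps: erasing derivations have bounded
cost, a chain in which one symbol always yields the whole word can be replaced by one of bounded
cost, and at most `n - 1` branchings into two nonempty parts remain. So a search among paths of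
linear length finds every word of the language.

Algorithms are programs on finitely many stacks, built with `bind`, `loop` and `lift`; `Runs`
records the result, the final store and a bound on the heights. Each stack becomes one tape of a
Turing machine, so that heights bound scanned cells (`StackProg.toTM_outputs`). -/

/-- The contents of finitely many stacks, the stack `i` having the alphabet `Γ i`. The head of a
list is the top of the stack. -/
def Store {ι : Type} (Γ : ι → Type) : Type := ∀ i, List (Γ i)

namespace Store

variable {ι : Type} {Γ : ι → Type}

open scoped Classical in
/-- Replace the content of stack `i`. -/
noncomputable def set (σ : Store Γ) (i : ι) (l : List (Γ i)) : Store Γ :=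
  Function.update σ i l

/-- All stacks are empty. -/
def empty (Γ : ι → Type) : Store Γ := fun _ => []

/-- All stacks have height at most `L`. -/
def Fits (L : ℕ) (σ : Store Γ) : Prop := ∀ i, (σ i).length ≤ L

open scoped Classical in
theorem set_same (σ : Store Γ) (i : ι) (l : List (Γ i)) : σ.set i l i = l :=
  Function.update_self ..

open scoped Classical in
theorem set_of_ne (σ : Store Γ) {i j : ι} (h : j ≠ i) (l : List (Γ i)) : σ.set i l j = σ j :=
  Function.update_of_ne h ..

open scoped Classical in
theorem set_eq_self (σ : Store Γ) (i : ι) : σ.set i (σ i) = σ :=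
  Function.update_eq_self ..

open scoped Classical in
theorem set_set (σ : Store Γ) (i : ι) (l l' : List (Γ i)) : (σ.set i l).set i l' = σ.set i l' :=
  Function.update_idem ..

theorem Fits.set {L : ℕ} {σ : Store Γ} (h : σ.Fits L) {i : ι} {l : List (Γ i)}
    (hl : l.length ≤ L) : (σ.set i l).Fits L := by
  intro j
  rcases eq_or_ne j i with rfl | hj
  · rwa [set_same]
  · rw [set_of_ne _ hj]; exact h j

theorem Fits.mono {L L' : ℕ} {σ : Store Γ} (h : σ.Fits L) (hL : L ≤ L') : σ.Fits L' :=
  fun i => (h i).trans hL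

end Store

/-- Instructions of stack programs with control points `Q` and results `R`. -/
inductive StackInstr {ι : Type} (Γ : ι → Type) (Q R : Type) : Type
  | ret (r : R)
  | jump (q : Q)
  | push (i : ι) (s : Γ i) (q : Q)
  | pop (i : ι) (k : Option (Γ i) → Q)

/-- Rename the control points by `f`, and replace `ret r` by `g r`. -/
def StackInstr.subst {ι : Type} {Γ : ι → Type} {Q R Q' R' : Type} (f : Q → Q')
    (g : R → StackInstr Γ Q' R') : StackInstr Γ Q R → StackInstr Γ Q' R'
  | ret r => g r
  | jump q => jump (f q)
  | push i s q => push i s (f q)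
  | pop i k => pop i fun o => f (k o)

theorem StackInstr.subst_ret {ι : Type} {Γ : ι → Type} {Q R : Type} (x : StackInstr Γ Q R) :
    x.subst (fun q => q) .ret = x := by
  cases x <;> rfl

/-- Rename the stacks along `e`. -/
def StackInstr.lift {ι κ : Type} {Γ : ι → Type} {Q R : Type} (e : κ → ι) :
    StackInstr (fun j => Γ (e j)) Q R → StackInstr Γ Q R
  | ret r => ret r
  | jump q => jump q
  | push i s q => push (e i) s q
  | pop i k => pop (e i) k

/-- Deterministic programs that work on stacks and return an element of `R`. -/
structure StackProg {ι : Type} (Γ : ι → Type) (R : Type) where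
  /-- control points -/
  Q : Type
  finite_Q : Finite Q
  q₀ : Q
  instr : Q → StackInstr Γ Q R

namespace StackProg

variable {ι κ : Type} {Γ : ι → Type} {A B R : Type}

/-- One step of a program; `none` if it has returned. -/
noncomputable def next (P : StackProg Γ R) (c : P.Q × Store Γ) : Option (P.Q × Store Γ) :=
  match P.instr c.1 with
  | .ret _ => none
  | .jump q => some (q, c.2)
  | .push i s q => some (q, c.2.set i (s :: c.2 i))
  | .pop i k => some (k (c.2 i).head?, c.2.set i (c.2 i).tail)

/-- `P.Path L c d`: the computation from `c` reaches `d`, the stacks having height at most `L`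
after every step. -/
def Path (P : StackProg Γ R) (L : ℕ) : P.Q × Store Γ → P.Q × Store Γ → Prop :=
  Relation.ReflTransGen fun c d => P.next c = some d ∧ d.2.Fits L

/-- `P.Runs σ r τ L`: started with the store `σ`, the program returns `r` and leaves the store `τ`,
and the heights of the stacks never exceed `L`. -/
def Runs (P : StackProg Γ R) (σ : Store Γ) (r : R) (τ : Store Γ) (L : ℕ) : Prop :=
  σ.Fits L ∧ ∃ q, P.Path L (P.q₀, σ) (q, τ) ∧ P.instr q = .ret r

theorem Path.fits {P : StackProg Γ R} {L : ℕ} {c d : P.Q × Store Γ} (h : P.Path L c d)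
    (hc : c.2.Fits L) : d.2.Fits L := by
  rcases Relation.ReflTransGen.cases_tail h with rfl | ⟨e, -, -, he⟩
  exacts [hc, he]

theorem Runs.fits {P : StackProg Γ R} {σ τ : Store Γ} {r : R} {L : ℕ} (h : P.Runs σ r τ L) :
    τ.Fits L := by
  obtain ⟨hσ, q, hp, -⟩ := h
  exact hp.fits hσ

theorem Runs.mono {P : StackProg Γ R} {σ τ : Store Γ} {r : R} {L L' : ℕ} (h : P.Runs σ r τ L)
    (hL : L ≤ L') : P.Runs σ r τ L' := by
  obtain ⟨hσ, q, hp, hq⟩ := h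
  exact ⟨hσ.mono hL, q, Relation.ReflTransGen.mono (fun _ _ h => ⟨h.1, h.2.mono hL⟩) _ _ hp, hq⟩

theorem Runs.congr {P : StackProg Γ R} {σ τ τ' : Store Γ} {r : R} {L : ℕ} (h : P.Runs σ r τ L)
    (hτ : τ = τ') : P.Runs σ r τ' L :=
  hτ ▸ h

/-- The program that returns `r` immediately. -/
def pure (Γ : ι → Type) (r : R) : StackProg Γ R where
  Q := Unit
  finite_Q := inferInstance
  q₀ := ()
  instr _ := .ret r

theorem runs_pure {σ : Store Γ} {r : R} {L : ℕ} (h : σ.Fits L) : (pure Γ r).Runs σ r σ L :=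
  ⟨h, (), .refl, rfl⟩

/-- Push `s` on stack `i`. -/
def push (i : ι) (s : Γ i) : StackProg Γ Unit where
  Q := Bool
  finite_Q := inferInstance
  q₀ := false
  instr b := bif b then .ret () else .push i s true

theorem runs_push {σ : Store Γ} {i : ι} {s : Γ i} {L : ℕ} (h : σ.Fits L)
    (hi : (σ i).length + 1 ≤ L) : (push i s).Runs σ () (σ.set i (s :: σ i)) L :=
  ⟨h, true, .single ⟨rfl, h.set (by simpa using hi)⟩, rfl⟩

/-- Pop the top of stack `i` and return it, or return `none` if the stack is empty. -/
def pop (i : ι) [Finite (Γ i)] : StackProg Γ (Option (Γ i)) where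
  Q := Option (Option (Γ i))
  finite_Q := inferInstance
  q₀ := none
  instr q := q.elim (.pop i some) .ret

theorem runs_pop {σ : Store Γ} {i : ι} [Finite (Γ i)] {L : ℕ} (h : σ.Fits L) :
    (pop i).Runs σ (σ i).head? (σ.set i (σ i).tail) L :=
  ⟨h, some (σ i).head?, .single ⟨rfl, h.set (by have := h i; simp; omega)⟩, rfl⟩

/-- Run `P`, then `K a`, where `a` is the result of `P`. -/
def bind [Finite A] (P : StackProg Γ A) (K : A → StackProg Γ B) : StackProg Γ B where
  Q := P.Q ⊕ (Σ a, (K a).Q)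
  finite_Q := by
    have := P.finite_Q
    have := fun a => (K a).finite_Q
    infer_instance
  q₀ := .inl P.q₀
  instr := Sum.elim
    (fun q => (P.instr q).subst .inl fun a => .jump (.inr ⟨a, (K a).q₀⟩))
    (fun q => ((K q.1).instr q.2).subst (fun p => .inr ⟨q.1, p⟩) .ret)

/-- The common engine of `bind` and `loop`: a program that contains a renamed copy of `P` imitates
every step of `P`, because `g` alters only the `ret` instructions, which make no step. -/
theorem next_subst {P : StackProg Γ A} {P' : StackProg Γ B} {f : P.Q → P'.Q}
    {g : A → StackInstr Γ P'.Q B} (h : ∀ q, P'.instr (f q) = (P.instr q).subst f g)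
    {c d : P.Q × Store Γ} (hcd : P.next c = some d) :
    P'.next (f c.1, c.2) = some (f d.1, d.2) := by
  unfold next at hcd ⊢
  simp only [h]
  cases hi : P.instr c.1 <;> simp only [hi] at hcd <;> simp_all [StackInstr.subst]
  all_goals subst hcd; simp

theorem Path.subst {P : StackProg Γ A} {P' : StackProg Γ B} {f : P.Q → P'.Q}
    {g : A → StackInstr Γ P'.Q B} (h : ∀ q, P'.instr (f q) = (P.instr q).subst f g) {L : ℕ}
    {c d : P.Q × Store Γ} (hcd : P.Path L c d) : P'.Path L (f c.1, c.2) (f d.1, d.2) :=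
  Relation.ReflTransGen.lift (fun c : P.Q × Store Γ => (f c.1, c.2))
    (fun _ _ h' => ⟨next_subst h h'.1, h'.2⟩) _ _ hcd

theorem Runs.bind [Finite A] {P : StackProg Γ A} {K : A → StackProg Γ B} {σ τ υ : Store Γ} {a : A}
    {b : B} {L : ℕ} (h : P.Runs σ a τ L) (hK : (K a).Runs τ b υ L) :
    (P.bind K).Runs σ b υ L := by
  obtain ⟨hσ, q, hp, hq⟩ := h
  obtain ⟨hτ, q', hp', hq'⟩ := hK
  refine ⟨hσ, .inr ⟨a, q'⟩, ?_, ?_⟩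
  · refine Relation.ReflTransGen.trans
      (Path.subst (P' := P.bind K) (f := Sum.inl) (fun q => rfl) hp) ?_
    refine Relation.ReflTransGen.head (b := ((.inr ⟨a, (K a).q₀⟩ : (P.bind K).Q), τ)) ⟨?_, hτ⟩
      (Path.subst (P' := P.bind K) (f := fun p => Sum.inr ⟨a, p⟩) (fun q => rfl) hp')
    simp [next, StackProg.bind, hq, StackInstr.subst]
  · simp [StackProg.bind, hq', StackInstr.subst]

/-- Run `body a`; if it returns `inl a'`, continue with `a'`, if it returns `inr b`, return `b`. -/
def loop [Finite A] (body : A → StackProg Γ (A ⊕ B)) (a : A) : StackProg Γ B where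
  Q := Σ a, (body a).Q
  finite_Q := by
    have := fun a => (body a).finite_Q
    infer_instance
  q₀ := ⟨a, (body a).q₀⟩
  instr q := ((body q.1).instr q.2).subst (fun p => ⟨q.1, p⟩)
    (Sum.elim (fun a' => .jump ⟨a', (body a').q₀⟩) .ret)

theorem Runs.loop_done [Finite A] {body : A → StackProg Γ (A ⊕ B)} {a : A} {b : B}
    {σ τ : Store Γ} {L : ℕ} (h : (body a).Runs σ (.inr b) τ L) : (loop body a).Runs σ b τ L := by
  obtain ⟨hσ, q, hp, hq⟩ := h
  refine ⟨hσ, ⟨a, q⟩, Path.subst (P' := loop body a) (f := fun p => ⟨a, p⟩) (fun q => rfl) hp, ?_⟩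
  simp [loop, hq, StackInstr.subst]

theorem Runs.loop_step [Finite A] {body : A → StackProg Γ (A ⊕ B)} {a a' : A} {b : B}
    {σ τ υ : Store Γ} {L : ℕ} (h : (body a).Runs σ (.inl a') τ L)
    (h' : (loop body a').Runs τ b υ L) : (loop body a).Runs σ b υ L := by
  obtain ⟨hσ, q, hp, hq⟩ := h
  obtain ⟨hτ, q', hp', hq'⟩ := h'
  refine ⟨hσ, q', ?_, hq'⟩
  refine Relation.ReflTransGen.trans
    (Path.subst (P' := loop body a) (f := fun p => ⟨a, p⟩) (fun q => rfl) hp) ?_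
  -- `loop body a'` and `loop body a` differ only in the initial control point, so the remaining
  -- path is carried over by the identity renaming.
  refine Relation.ReflTransGen.head (b := ((⟨a', (body a').q₀⟩ : (loop body a).Q), τ)) ⟨?_, hτ⟩
    (Path.subst (P := loop body a') (P' := loop body a) (fun q => (StackInstr.subst_ret _).symm) hp')
  simp [next, loop, hq, StackInstr.subst]

/-- Run a program on some of the stacks. -/
def lift (e : κ → ι) (P : StackProg (fun j => Γ (e j)) R) : StackProg Γ R where
  Q := P.Q
  finite_Q := P.finite_Q
  q₀ := P.q₀
  instr q := (P.instr q).lift e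

/-- `merge` is meant to fill in the stacks outside the range of `e` with frozen contents. In the
application the oracle program runs in this way beside the search stacks. -/
theorem Runs.lift {e : κ → ι} {P : StackProg (fun j => Γ (e j)) R}
    {r : R} {L : ℕ} {σ' τ' : Store fun j => Γ (e j)} (h : P.Runs σ' r τ' L)
    (merge : Store (fun j => Γ (e j)) → Store Γ) (hm : ∀ σ j, merge σ (e j) = σ j)
    (hset : ∀ σ j l, (merge σ).set (e j) l = merge (σ.set j l))
    (hfits : ∀ σ, σ.Fits L → (merge σ).Fits L) :
    (P.lift e).Runs (merge σ') r (merge τ') L := by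
  obtain ⟨hσ, q, hp, hq⟩ := h
  refine ⟨hfits _ hσ, q, ?_, by simp [StackProg.lift, hq, StackInstr.lift]⟩
  refine Relation.ReflTransGen.lift (fun c : P.Q × Store _ => (c.1, merge c.2))
    (fun c d h' => ⟨?_, hfits _ h'.2⟩) _ _ hp
  have h1 := h'.1
  unfold next at h1 ⊢
  simp only [StackProg.lift] at h1 ⊢
  cases hi : P.instr c.1 <;> simp only [hi] at h1 <;> simp_all [StackInstr.lift]
  all_goals subst h1; simp

/-- Pop the symbols of stack `i` one after the other, and run `body s` for every symbol `s`. -/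
def drain (i : ι) [Finite (Γ i)] (body : Γ i → StackProg Γ Unit) : StackProg Γ Unit :=
  loop (fun _ : Unit => (pop i).bind fun o =>
    o.elim (pure Γ (.inr ())) fun s => (body s).bind fun _ => pure Γ (.inl ())) ()

theorem runs_drain_nil {i : ι} [Finite (Γ i)] {body : Γ i → StackProg Γ Unit} {σ : Store Γ} {L : ℕ}
    (hσ : σ.Fits L) (h : σ i = []) : (drain i body).Runs σ () σ L := by
  have h1 := runs_pop (i := i) hσ
  have h2 : σ.set i (σ i).tail = σ := by
    conv_rhs => rw [← σ.set_eq_self i]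
    rw [h, List.tail_nil]
  rw [h2, h] at h1
  exact Runs.loop_done (Runs.bind h1 (by exact runs_pure hσ))

theorem runs_drain_cons {i : ι} [Finite (Γ i)] {body : Γ i → StackProg Γ Unit} {σ τ υ : Store Γ}
    {L : ℕ} {s : Γ i} {l : List (Γ i)} (hσ : σ.Fits L) (h : σ i = s :: l)
    (hb : (body s).Runs (σ.set i l) () τ L) (hd : (drain i body).Runs τ () υ L) :
    (drain i body).Runs σ () υ L := by
  have h1 := runs_pop (i := i) hσ
  simp only [h, List.head?_cons, List.tail_cons] at h1
  exact Runs.loop_step (a' := ())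
    (Runs.bind h1 (by exact Runs.bind hb (by exact runs_pure hb.fits))) hd

/-- Empty the stack `i`. -/
def clear (i : ι) [Finite (Γ i)] : StackProg Γ Unit := drain i fun _ => pure Γ ()

theorem runs_clear {i : ι} [Finite (Γ i)] {σ : Store Γ} {L : ℕ} (hσ : σ.Fits L) :
    (clear i).Runs σ () (σ.set i []) L := by
  induction hl : σ i generalizing σ with
  | nil => rw [← hl, σ.set_eq_self]; exact runs_drain_nil hσ hl
  | cons s l ih =>
    have h1 : (σ.set i l).Fits L := hσ.set (by have := hσ i; simp [hl] at this; omega)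
    have h2 := ih h1 (σ.set_same i l)
    rw [σ.set_set] at h2
    exact runs_drain_cons hσ hl (runs_pure h1) h2

/-- Empty all stacks in a list. -/
def clearList [∀ i, Finite (Γ i)] : List ι → StackProg Γ Unit
  | [] => pure Γ ()
  | i :: l => (clear i).bind fun _ => clearList l

theorem runs_clearList [∀ i, Finite (Γ i)] (l : List ι) {σ : Store Γ} {L : ℕ} (hσ : σ.Fits L) :
    ∃ τ, (clearList l).Runs σ () τ L ∧ (∀ i ∈ l, τ i = []) ∧ ∀ i ∉ l, τ i = σ i := by
  induction l generalizing σ with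
  | nil => exact ⟨σ, runs_pure hσ, by simp⟩
  | cons i l ih =>
    have h1 := runs_clear (i := i) hσ
    obtain ⟨τ, h2, h3, h4⟩ := ih h1.fits
    refine ⟨τ, h1.bind h2, fun j hj => ?_, fun j hj => ?_⟩
    · by_cases hl : j ∈ l
      · exact h3 j hl
      · obtain rfl : j = i := by simpa [hl] using hj
        rw [h4 j hl, σ.set_same]
    · rw [List.mem_cons, not_or] at hj
      rw [h4 j hj.2, σ.set_of_ne hj.1]

/-- Empty all stacks. -/
noncomputable def clearAll (Γ : ι → Type) [Finite ι] [∀ i, Finite (Γ i)] : StackProg Γ Unit :=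
  clearList (Set.toFinite (Set.univ : Set ι)).toFinset.toList

theorem runs_clearAll [Finite ι] [∀ i, Finite (Γ i)] {σ : Store Γ} {L : ℕ} (hσ : σ.Fits L) :
    (clearAll Γ).Runs σ () (Store.empty Γ) L := by
  obtain ⟨τ, h, h', -⟩ := runs_clearList (Set.toFinite (Set.univ : Set ι)).toFinset.toList hσ
  obtain rfl : τ = Store.empty Γ := funext fun i => h' i (by simp)
  exact h

/-- Move the symbols of stack `i` one after the other to stack `j`, changing them by `f`. -/
def move (i j : ι) [Finite (Γ i)] (f : Γ i → Γ j) : StackProg Γ Unit := drain i fun s => push j (f s)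

theorem runs_move {i j : ι} (hij : i ≠ j) [Finite (Γ i)] (f : Γ i → Γ j) {σ : Store Γ} {L : ℕ}
    (hσ : σ.Fits L) (hl : (σ i).length + (σ j).length ≤ L) :
    (move i j f).Runs σ () ((σ.set i []).set j (((σ i).map f).reverse ++ σ j)) L := by
  induction h : σ i generalizing σ with
  | nil =>
    rw [← h, σ.set_eq_self, h, List.map_nil, List.reverse_nil, List.nil_append, σ.set_eq_self]
    exact runs_drain_nil hσ h
  | cons s l ih =>
    rw [h, List.length_cons] at hl
    have h1 : (σ.set i l).Fits L := hσ.set (by omega)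
    have h2 := runs_push (i := j) (s := f s) h1 (by rw [σ.set_of_ne hij.symm]; omega)
    rw [σ.set_of_ne hij.symm] at h2
    have hi : ((σ.set i l).set j (f s :: σ j)) i = l := by
      rw [Store.set_of_ne _ hij, σ.set_same]
    have h3 := ih h2.fits (by rw [hi, Store.set_same, List.length_cons]; omega) hi
    rw [Store.set_same] at h3
    have h4 : (((σ.set i l).set j (f s :: σ j)).set i []).set j ((l.map f).reverse ++ f s :: σ j)
        = (σ.set i []).set j (((s :: l).map f).reverse ++ σ j) := by
      funext k
      rcases eq_or_ne k j with rfl | hk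
      · simp [Store.set_same]
      · rcases eq_or_ne k i with rfl | hk'
        · simp [Store.set_of_ne _ hk, Store.set_same]
        · simp [Store.set_of_ne _ hk, Store.set_of_ne _ hk']
    rw [h4] at h3
    exact runs_drain_cons hσ h h2 h3

/-- Push a list of symbols, the last one first. -/
def pushList (i : ι) : List (Γ i) → StackProg Γ Unit
  | [] => pure Γ ()
  | s :: v => (pushList i v).bind fun _ => push i s

theorem runs_pushList {i : ι} (v : List (Γ i)) {σ : Store Γ} {L : ℕ} (hσ : σ.Fits L)
    (hl : v.length + (σ i).length ≤ L) : (pushList i v).Runs σ () (σ.set i (v ++ σ i)) L := by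
  induction v with
  | nil => rw [List.nil_append, σ.set_eq_self]; exact runs_pure hσ
  | cons s v ih =>
    rw [List.length_cons] at hl
    have h1 := ih (by omega)
    have h2 := runs_push (i := i) (s := s) h1.fits
      (by rw [σ.set_same, List.length_append]; omega)
    rw [σ.set_same, σ.set_set] at h2
    exact h1.bind h2

end StackProg

/-! ### Stack programs as Turing machines -/

section WordTape

variable {S : Type} (b : S)

theorem wordTape_natCast (w : List S) (n : ℕ) : wordTape b w n = w.getD n b := rfl

theorem wordTape_length (w : List S) : wordTape b w w.length = b := by
  simp [wordTape_natCast]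

theorem wordTape_concat_length (w : List S) (s : S) : wordTape b (w ++ [s]) w.length = s := by
  simp [wordTape_natCast]

theorem wordTape_nil : wordTape b [] = fun _ => b := by
  funext p
  cases p <;> simp [wordTape]

theorem update_wordTape_length (w : List S) (s : S) :
    Function.update (wordTape b w) w.length s = wordTape b (w ++ [s]) := by
  funext p
  cases p with
  | ofNat n =>
    rcases eq_or_ne n w.length with rfl | hn
    · simpa using (wordTape_concat_length b w s).symm
    · rw [Function.update_of_ne (by simpa using hn)]
      simp only [wordTape, List.getD_eq_getElem?_getD]
      rcases lt_or_gt_of_ne hn with h | h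
      · rw [List.getElem?_append_left h]
      · rw [List.getElem?_eq_none h.le, List.getElem?_eq_none (by simp; omega)]
  | negSucc n => rw [Function.update_of_ne (by simp)]; rfl

theorem update_wordTape_concat_length (w : List S) (s : S) :
    Function.update (wordTape b (w ++ [s])) w.length b = wordTape b w := by
  rw [← update_wordTape_length, Function.update_idem, Function.update_eq_iff]
  exact ⟨(wordTape_length b w).symm, fun _ _ => rfl⟩

end WordTape

namespace MultiTapeTM

variable {α γ : Type} {M : MultiTapeTM α γ}

/-- If the computation from `c` halts and all its configurations satisfy `p`, then all
configurations that are reached from `c` satisfy `p`. -/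
theorem forall_of_reflTransGen (p : M.Config → Prop) {c d : M.Config} (hc : p c)
    (h : Relation.ReflTransGen (fun c d => M.step c = some d ∧ p d) c d) (hd : M.step d = none)
    (e : M.Config) (he : Relation.ReflTransGen (fun c d => M.step c = some d) c e) : p e := by
  induction h using Relation.ReflTransGen.head_induction_on with
  | refl =>
    rcases Relation.ReflTransGen.cases_head he with rfl | ⟨f, hf, -⟩
    · exact hc
    · simp [hd] at hf
  | head h h' ih =>
    rcases Relation.ReflTransGen.cases_head he with rfl | ⟨f, hf, hf'⟩
    · exact hc
    · rw [h.1, Option.some.injEq] at hf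
      subst hf
      exact ih h.2 hf'

end MultiTapeTM

namespace StackProg

variable {ι : Type} {Γ : ι → Type} {R α γ : Type}

open scoped Classical in
/-- The transition function of the Turing machine for `P`. In the state `none` the machine moves the
head of tape `i₁` to the right end of the input. The state `some (q, false)` corresponds to the
control point `q`, and `some (q, true)` is used after the first half of a pop instruction. -/
noncomputable def tmδ (P : StackProg Γ R) (i₁ : ι) (q : Option (P.Q × Bool))
    (s : ι → Option (Σ i, Γ i)) :
    Option (Option (P.Q × Bool) × (ι → Option (Σ i, Γ i) × HeadMove)) :=
  match q with
  | none =>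
    if s i₁ = none then some (some (P.q₀, false), fun j => (s j, .stay))
    else some (none, fun j => (s j, if j = i₁ then .right else .stay))
  | some (q, false) =>
    match P.instr q with
    | .ret _ => none
    | .jump q' => some (some (q', false), fun j => (s j, .stay))
    | .push i g q' => some (some (q', false),
        fun j => if j = i then (some ⟨i, g⟩, .right) else (s j, .stay))
    | .pop i _ => some (some (q, true), fun j => (s j, if j = i then .left else .stay))
  | some (q, true) =>
    match P.instr q with
    | .pop i k =>
      match s i with
      | none => some (some (k none, false), fun j => (s j, if j = i then .right else .stay))
      | some ⟨i', g⟩ =>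
        if h : i' = i then
          some (some (k (some (h ▸ g)), false), fun j => (if j = i then none else s j, .stay))
        else none
    | _ => none

/-- The tape that represents a stack. -/
def stackTape (i : ι) (l : List (Γ i)) : ℤ → Option (Σ i, Γ i) :=
  wordTape none (l.reverse.map fun g => some ⟨i, g⟩)

theorem stackTape_length (i : ι) (l : List (Γ i)) : stackTape i l l.length = none := by
  simpa [stackTape] using wordTape_length (none : Option (Σ i, Γ i)) (l.reverse.map fun g => some ⟨i, g⟩)

theorem stackTape_cons_length (i : ι) (g : Γ i) (l : List (Γ i)) :
    stackTape i (g :: l) l.length = some ⟨i, g⟩ := by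
  simpa [stackTape] using wordTape_concat_length (none : Option (Σ i, Γ i))
    (l.reverse.map fun g => some ⟨i, g⟩) (some ⟨i, g⟩)

theorem update_stackTape_push (i : ι) (g : Γ i) (l : List (Γ i)) :
    Function.update (stackTape i l) l.length (some ⟨i, g⟩) = stackTape i (g :: l) := by
  simpa [stackTape] using update_wordTape_length (none : Option (Σ i, Γ i))
    (l.reverse.map fun g => some ⟨i, g⟩) (some ⟨i, g⟩)

theorem update_stackTape_pop (i : ι) (g : Γ i) (l : List (Γ i)) :
    Function.update (stackTape i (g :: l)) l.length none = stackTape i l := by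
  simpa [stackTape] using update_wordTape_concat_length (none : Option (Σ i, Γ i))
    (l.reverse.map fun g => some ⟨i, g⟩) (some ⟨i, g⟩)

variable [Finite ι] [∀ i, Finite (Γ i)]

/-- The Turing machine for `P`, with input tape `i₁` and output tape `i₂`. -/
noncomputable def toTM (P : StackProg Γ R) (i₁ i₂ : ι) (enc : α → Γ i₁)
    (henc : Function.Injective enc) (dec : γ → Γ i₂) (hdec : Function.Injective dec) :
    MultiTapeTM α γ where
  Q := Option (P.Q × Bool)
  ι := ι
  S := Option (Σ i, Γ i)
  finite_Q := by
    have := P.finite_Q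
    infer_instance
  finite_ι := inferInstance
  finite_S := inferInstance
  blank := none
  inSym a := some ⟨i₁, enc a⟩
  inSym_injective a b h := henc (by simpa using h)
  inSym_ne_blank a := by simp
  outSym a := some ⟨i₂, dec a⟩
  outSym_injective a b h := hdec (by simpa using h)
  outSym_ne_blank a := by simp
  inTape := i₁
  outTape := i₂
  q₀ := none
  δ := P.tmδ i₁

/-! ### Correctness of the Turing machine of a stack program -/

section toTM

variable (P : StackProg Γ R) (i₁ i₂ : ι) (enc : α → Γ i₁) (henc : Function.Injective enc)
  (dec : γ → Γ i₂) (hdec : Function.Injective dec)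

/-- The configuration of the Turing machine that corresponds to a configuration of `P`. -/
def tmConfig (c : P.Q × Store Γ) : (P.toTM i₁ i₂ enc henc dec hdec).Config where
  state := some (c.1, false)
  cells i := stackTape i (c.2 i)
  head i := (c.2 i).length

/-- The step relation restricted to configurations whose heads are in the cells `-1, …, L`. -/
def TMStep (L : ℕ) (c d : (P.toTM i₁ i₂ enc henc dec hdec).Config) : Prop :=
  (P.toTM i₁ i₂ enc henc dec hdec).step c = some d ∧ ∀ i, d.head i ∈ Set.Icc (-1) (L : ℤ)

theorem toTM_step {q : Option (P.Q × Bool)} {cells cells' : ι → ℤ → Option (Σ i, Γ i)}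
    {head head' : ι → ℤ} (q' : Option (P.Q × Bool)) (a : ι → Option (Σ i, Γ i) × HeadMove)
    (h : P.tmδ i₁ q (fun i => cells i (head i)) = some (q', a))
    (hcells : ∀ i, cells' i = Function.update (cells i) (head i) (a i).1)
    (hhead : ∀ i, head' i = head i + (a i).2.shift) :
    (P.toTM i₁ i₂ enc henc dec hdec).step ⟨q, cells, head⟩ = some ⟨q', cells', head'⟩ := by
  obtain rfl : cells' = _ := funext hcells
  obtain rfl : head' = _ := funext hhead
  have h' : (P.toTM i₁ i₂ enc henc dec hdec).δ q (fun i => cells i (head i)) = some (q', a) := h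
  simp only [MultiTapeTM.step, h']
  rfl

theorem tmConfig_head_mem {L : ℕ} {c : P.Q × Store Γ} (h : c.2.Fits L) (i : ι) :
    (P.tmConfig i₁ i₂ enc henc dec hdec c).head i ∈ Set.Icc (-1) (L : ℤ) := by
  have := h i
  simp only [tmConfig, Set.mem_Icc]
  omega

/-- Every head rests on the first blank cell beyond the top of its stack. A push is one step; a pop
must first move left to see the top. On an empty stack this leads to cell `-1`, whose blank signals
emptiness, which is why the window of `TMStep` begins at `-1`. -/
theorem reflTransGen_tmStep_of_next {L : ℕ} {c d : P.Q × Store Γ} (hcd : P.next c = some d)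
    (hc : c.2.Fits L) (hd : d.2.Fits L) :
    Relation.ReflTransGen (P.TMStep i₁ i₂ enc henc dec hdec L)
      (P.tmConfig i₁ i₂ enc henc dec hdec c) (P.tmConfig i₁ i₂ enc henc dec hdec d) := by
  classical
  obtain ⟨q, σ⟩ := c
  have hd' := P.tmConfig_head_mem i₁ i₂ enc henc dec hdec hd
  unfold next at hcd
  cases hi : P.instr q with
  | ret r => simp [hi] at hcd
  | jump q' =>
    simp only [hi, Option.some.injEq] at hcd
    subst hcd
    refine .single ⟨P.toTM_step i₁ i₂ enc henc dec hdec _ _ (by simp only [tmδ, hi]; rfl)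
      (fun j => ?_) (fun j => ?_), hd'⟩
    · simp
    · simp [HeadMove.shift]
  | push i g q' =>
    simp only [hi, Option.some.injEq] at hcd
    subst hcd
    refine .single ⟨P.toTM_step i₁ i₂ enc henc dec hdec _ _ (by simp only [tmδ, hi]; rfl)
      (fun j => ?_) (fun j => ?_), hd'⟩
    · rcases eq_or_ne j i with rfl | hj
      · simp [Store.set_same, update_stackTape_push]
      · simp [Store.set_of_ne _ hj, hj]
    · rcases eq_or_ne j i with rfl | hj
      · simp [Store.set_same, HeadMove.shift]
      · simp [Store.set_of_ne _ hj, hj, HeadMove.shift]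
  | pop i k =>
    simp only [hi, Option.some.injEq] at hcd
    subst hcd
    let head : ι → ℤ := fun j => if j = i then (σ j).length - 1 else (σ j).length
    have hi1 : head i = (σ i).length - 1 := if_pos rfl
    have hj1 : ∀ j, j ≠ i → head j = (σ j).length := fun j hj => if_neg hj
    refine .head (b := ⟨some (q, true), fun j => stackTape j (σ j), head⟩)
      ⟨P.toTM_step i₁ i₂ enc henc dec hdec _ _ (by simp only [tmδ, hi]; rfl)
      (fun j => ?_) (fun j => ?_), fun (j : ι) => ?_⟩ (.single ⟨?_, hd'⟩)
    · simp
    · rcases eq_or_ne j i with rfl | hj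
      · simp [hi1, HeadMove.shift, sub_eq_add_neg]
      · simp [hj1 j hj, HeadMove.shift, hj]
    · have := hc j
      simp only [Set.mem_Icc, head] at this ⊢
      split_ifs <;> omega
    · cases hs : σ i with
      | nil =>
        have h1 : stackTape i (σ i) (head i) = none := by
          rw [hi1, hs]; rfl
        refine P.toTM_step i₁ i₂ enc henc dec hdec _ _ (by simp only [tmδ, hi, h1]; rfl)
          (fun j => ?_) (fun j => ?_)
        · rcases eq_or_ne j i with rfl | hj
          · simp [Store.set_same, hs]
          · simp [Store.set_of_ne _ hj]
        · rcases eq_or_ne j i with rfl | hj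
          · simp [Store.set_same, hs, hi1, HeadMove.shift]
          · simp [Store.set_of_ne _ hj, hj, hj1 j hj, HeadMove.shift]
      | cons g l =>
        have hi2 : head i = l.length := by simp [hi1, hs]
        have h1 : stackTape i (σ i) (head i) = some ⟨i, g⟩ := by
          rw [hi2, hs]; exact stackTape_cons_length i g l
        -- Tape `i` carries only symbols tagged with `i`, so the comparison of tags in `tmδ`
        -- succeeds.
        refine P.toTM_step i₁ i₂ enc henc dec hdec _ _
          (by simp only [tmδ, hi, h1, dite_true]; rfl) (fun j => ?_) (fun j => ?_)
        · rcases eq_or_ne j i with rfl | hj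
          · simp [Store.set_same, hs, hi2, update_stackTape_pop]
          · simp [Store.set_of_ne _ hj, hj]
        · rcases eq_or_ne j i with rfl | hj
          · simp [Store.set_same, hi2, HeadMove.shift]
          · simp [Store.set_of_ne _ hj, hj1 j hj, HeadMove.shift]

theorem reflTransGen_tmStep_of_path {L : ℕ} {c d : P.Q × Store Γ} (hcd : P.Path L c d)
    (hc : c.2.Fits L) :
    Relation.ReflTransGen (P.TMStep i₁ i₂ enc henc dec hdec L)
      (P.tmConfig i₁ i₂ enc henc dec hdec c) (P.tmConfig i₁ i₂ enc henc dec hdec d) := by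
  induction hcd with
  | refl => exact .refl
  | tail h h' ih =>
    exact ih.trans (P.reflTransGen_tmStep_of_next i₁ i₂ enc henc dec hdec h'.1 (Path.fits h hc) h'.2)

-- The input written from left to right already is the stack `x.reverse`, with its top at the right
-- end. So the preliminary phase only moves one head over the nonblank cells, and nothing is copied.
open scoped Classical in
theorem reflTransGen_tmStep_start {L : ℕ} (x : List α) (hx : x.length ≤ L) :
    Relation.ReflTransGen (P.TMStep i₁ i₂ enc henc dec hdec L)
      ((P.toTM i₁ i₂ enc henc dec hdec).start x)
      (P.tmConfig i₁ i₂ enc henc dec hdec (P.q₀, (Store.empty Γ).set i₁ (x.reverse.map enc))) := by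
  have hnil : ∀ i, (Store.empty Γ i) = [] := fun _ => rfl
  set σ := (Store.empty Γ).set i₁ (x.reverse.map enc) with hσ
  have hlen : (σ i₁).length = x.length := by simp [hσ, Store.set_same]
  have hcells : (P.toTM i₁ i₂ enc henc dec hdec).start x =
      ⟨none, fun j => stackTape j (σ j), fun _ => 0⟩ := by
    have : ∀ j : ι, ((P.toTM i₁ i₂ enc henc dec hdec).start x).cells j = stackTape j (σ j) := by
      intro j
      rcases eq_or_ne j i₁ with rfl | hj
      · refine (if_pos rfl).trans ?_
        simp [toTM, hσ, Store.set_same, stackTape, Function.comp_def]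
      · refine (if_neg hj).trans ?_
        rw [hσ, Store.set_of_ne _ hj, hnil]
        exact (wordTape_nil _).symm
    change (⟨none, _, _⟩ : (P.toTM i₁ i₂ enc henc dec hdec).Config) = _
    congr 1
    exact funext this
  have hscan : ∀ n : ℕ, n ≤ x.length → Relation.ReflTransGen (P.TMStep i₁ i₂ enc henc dec hdec L)
      ((P.toTM i₁ i₂ enc henc dec hdec).start x)
      ⟨none, fun j => stackTape j (σ j), fun j : ι => if j = i₁ then (n : ℤ) else 0⟩ := by
    intro n hn
    induction n with
    | zero =>
      have h0 : (fun j : ι => if j = i₁ then ((0 : ℕ) : ℤ) else 0) = fun _ => 0 := by simp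
      rw [hcells, h0]
      exact .refl
    | succ n ih =>
      have h1 : stackTape i₁ (σ i₁) n ≠ none := by
        rw [stackTape, wordTape_natCast, List.getD_eq_getElem _ _ (by simp [hlen]; omega)]
        simp
      refine (ih (by omega)).tail ⟨P.toTM_step i₁ i₂ enc henc dec hdec _ _
        (by simp only [tmδ, if_true, h1, if_false]; rfl) (fun j => ?_) (fun j => ?_),
        fun (j : ι) => ?_⟩
      · simp
      · rcases eq_or_ne j i₁ with rfl | hj
        · simp [HeadMove.shift]
        · simp [HeadMove.shift, hj]
      · simp only [Set.mem_Icc]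
        split_ifs <;> omega
  have h1 : stackTape i₁ (σ i₁) x.length = none := by rw [← hlen]; exact stackTape_length _ _
  refine (hscan x.length le_rfl).tail ⟨P.toTM_step i₁ i₂ enc henc dec hdec _ _
    (by simp only [tmδ, if_true, h1]; rfl) (fun j => ?_) (fun j => ?_),
    P.tmConfig_head_mem i₁ i₂ enc henc dec hdec ?_⟩
  · simp
  · rcases eq_or_ne j i₁ with rfl | hj
    · simp [HeadMove.shift, hlen]
    · simp [HeadMove.shift, hj, hσ, Store.set_of_ne _ hj, hnil]
  · exact Store.Fits.set (fun i => by simp [hnil]) (by simpa using hx)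

/-- Determinism turns the head bound along the halting path into one for all reachable
configurations, and the window from `-1` to `L` has `L + 2` cells. The output is read off its stack
from bottom to top, hence `y.reverse`. -/
theorem toTM_outputs {x : List α} {y : List γ} {r : R} {τ : Store Γ} {L : ℕ}
    (h : P.Runs ((Store.empty Γ).set i₁ (x.reverse.map enc)) r τ L)
    (hy : τ i₂ = y.reverse.map dec) :
    (P.toTM i₁ i₂ enc henc dec hdec).Outputs x y ∧
      ∀ i, ((P.toTM i₁ i₂ enc henc dec hdec).scanned x i).encard ≤ (L + 2 : ℕ) := by
  obtain ⟨hσ, q, hp, hq⟩ := h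
  have hx : x.length ≤ L := by simpa [Store.set_same] using hσ i₁
  have hpath := (P.reflTransGen_tmStep_start i₁ i₂ enc henc dec hdec x hx).trans
    (P.reflTransGen_tmStep_of_path i₁ i₂ enc henc dec hdec hp hσ)
  have hhalt : (P.toTM i₁ i₂ enc henc dec hdec).step
      (P.tmConfig i₁ i₂ enc henc dec hdec (q, τ)) = none := by
    simp [MultiTapeTM.step, toTM, tmConfig, tmδ, hq]
  refine ⟨⟨_, Relation.ReflTransGen.mono (fun _ _ h => h.1) _ _ hpath, hhalt, ?_⟩, fun i => ?_⟩
  · simp [toTM, tmConfig, hy, stackTape, Function.comp_def]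
  · have hsub : (P.toTM i₁ i₂ enc henc dec hdec).scanned x i ⊆ Set.Icc (-1) (L : ℤ) := by
      rintro p ⟨c, hc, rfl⟩
      refine MultiTapeTM.forall_of_reflTransGen (fun c => ∀ i, c.head i ∈ Set.Icc (-1) (L : ℤ))
        (fun i => ?_) hpath hhalt c hc i
      simp [MultiTapeTM.start]
    refine (Set.encard_le_encard hsub).trans ?_
    rw [← Finset.coe_Icc, Set.encard_coe_eq_coe_finsetCard, Int.card_Icc]
    exact_mod_cast (by omega)

end toTM

end StackProg

/-! ### Enumerating all lists of digits -/

namespace Odometer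

variable {m : ℕ}

/-- The successor of a list of digits, the least significant digit coming first; `none` if all
digits are maximal. -/
def succ : List (Fin (m + 1)) → Option (List (Fin (m + 1)))
  | [] => none
  | d :: l => if h : d.val + 1 < m + 1 then some (⟨d + 1, h⟩ :: l) else (succ l).map (0 :: ·)

/-- The number with the given digits. -/
def value : List (Fin (m + 1)) → ℕ
  | [] => 0
  | d :: l => d + (m + 1) * value l

theorem value_lt (l : List (Fin (m + 1))) : value l < (m + 1) ^ l.length := by
  induction l with
  | nil => simp [value]
  | cons d l ih =>
    have hd := d.isLt
    rw [value, List.length_cons, pow_succ]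
    nlinarith

/-- Reduction modulo `m + 1` recovers the least significant digit. -/
theorem value_injective {l l' : List (Fin (m + 1))} (h : l.length = l'.length)
    (hv : value l = value l') : l = l' := by
  induction l generalizing l' with
  | nil => exact (List.length_eq_zero_iff.1 h.symm).symm
  | cons d l ih =>
    cases l' with
    | nil => simp at h
    | cons d' l' =>
      simp only [value] at hv
      have h1 := congrArg (· % (m + 1)) hv
      simp only [Nat.add_mul_mod_self_left, Nat.mod_eq_of_lt d.isLt, Nat.mod_eq_of_lt d'.isLt] at h1
      rw [h1, Nat.add_left_cancel_iff, Nat.mul_right_inj (by omega)] at hv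
      rw [Fin.ext h1, ih (by simpa using h) hv]

theorem length_of_succ {l l' : List (Fin (m + 1))} (h : succ l = some l') :
    l'.length = l.length := by
  induction l generalizing l' with
  | nil => simp [succ] at h
  | cons d l ih =>
    rw [succ] at h
    split_ifs at h with hd
    · cases h; simp
    · obtain ⟨l'', h1, rfl⟩ := Option.map_eq_some_iff.1 h
      simp [ih h1]

theorem value_of_succ {l l' : List (Fin (m + 1))} (h : succ l = some l') :
    value l' = value l + 1 := by
  induction l generalizing l' with
  | nil => simp [succ] at h
  | cons d l ih =>
    rw [succ] at h
    split_ifs at h with hd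
    · cases h; simp [value]; omega
    · obtain ⟨l'', h1, rfl⟩ := Option.map_eq_some_iff.1 h
      have := d.isLt
      simp only [value, ih h1, Fin.val_zero]
      rw [mul_add]
      omega

/-- Without a successor all digits equal `m`, so the value is the largest possible for this length
and the enumeration is complete. -/
theorem value_of_succ_eq_none {l : List (Fin (m + 1))} (h : succ l = none) :
    value l + 1 = (m + 1) ^ l.length := by
  induction l with
  | nil => simp [value]
  | cons d l ih =>
    rw [succ] at h
    split_ifs at h with hd
    have := d.isLt
    rw [value, List.length_cons, pow_succ, ← ih (by simpa using h)]
    have hd' : (d : ℕ) = m := by omega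
    rw [hd']
    ring

theorem value_replicate_zero (n : ℕ) : value (List.replicate n (0 : Fin (m + 1))) = 0 := by
  induction n with
  | zero => rfl
  | succ n ih => simp [List.replicate_succ, value, ih]

end Odometer

/-! ### Computation paths of oracle pushdown automata with given choices -/

namespace OracleNPDA

variable {α β γ : Type}

/-- The transitions of an oracle npda. -/
structure Trans (M : OracleNPDA α β γ) where
  /-- The state in which the transition applies. -/
  src : M.Q
  /-- The input symbol which the transition reads. -/
  sym : Option (InputSym α)
  /-- The topmost stack symbol for which the transition applies. -/
  top : M.Θ
  /-- The new state. -/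
  tgt : M.Q
  /-- The string that replaces the topmost stack symbol. -/
  word : List M.Θ
  /-- The symbol written on the output tape. -/
  out : Option γ
  /-- The symbol written on the query tape. -/
  qry : Option β
  mem : (tgt, word, out, qry) ∈ M.δ src sym top

instance [Finite α] : Finite (InputSym α) :=
  Finite.of_surjective
    (fun x : Option (Option α) => match x with
      | none => InputSym.cent
      | some none => InputSym.dollar
      | some (some a) => InputSym.letter a)
    (fun s => match s with
      | .cent => ⟨none, rfl⟩
      | .dollar => ⟨some none, rfl⟩
      | .letter a => ⟨some (some a), rfl⟩)

/-- Finiteness is what allows a choice to be coded by a digit. -/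
instance finite_trans (M : OracleNPDA α β γ) [Finite α] : Finite M.Trans := by
  have := M.finite_Q
  have := M.finite_Θ
  have := fun k : M.Q × Option (InputSym α) × M.Θ =>
    (M.finite_δ k.1 k.2.1 k.2.2).to_subtype
  exact Finite.of_surjective
    (fun t : Σ k : M.Q × Option (InputSym α) × M.Θ, ↥(M.δ k.1 k.2.1 k.2.2) =>
      (⟨t.1.1, t.1.2.1, t.1.2.2, _, _, _, _, t.2.2⟩ : M.Trans))
    (fun t => ⟨⟨(t.src, t.sym, t.top), ⟨_, t.mem⟩⟩, rfl⟩)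

variable (M : OracleNPDA α β γ) (A : Language β)

open scoped Classical in
/-- The step in which the transition `t` is chosen, if it applies. In the query state the choice is
ignored. -/
noncomputable def choiceStep (t : Option M.Trans) (c : M.Config) : Option M.Config :=
  if c.state = M.query then
    some ⟨if c.queryTape ∈ A then M.yes else M.no, c.input, c.stack, c.output, []⟩
  else t.bind fun t =>
    if t.src = c.state ∧ c.state ∉ M.halt ∧ (t.sym = none ∨ c.input.head? = t.sym) ∧
        c.stack.head? = some t.top then
      some ⟨t.tgt, if t.sym = none then c.input else c.input.tail, t.word ++ c.stack.tail,
        c.output ++ t.out.toList, c.queryTape ++ t.qry.toList⟩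
    else none

open scoped Classical in
/-- The outcome of the computation path from `c` with the given choices, if it is accepting. -/
noncomputable def pathOutcome : List (Option M.Trans) → M.Config → Option (List γ)
  | [], c => if c.state ∈ M.acc then some c.output else none
  | t :: l, c => if c.state ∈ M.acc then some c.output else
      (M.choiceStep A t c).bind (pathOutcome l)

variable {M A}

theorem step_of_choiceStep {t : Option M.Trans} {c d : M.Config}
    (h : M.choiceStep A t c = some d) : M.Step A c d := by
  obtain ⟨q, u, st, out, qt⟩ := c
  unfold choiceStep at h
  by_cases hq : q = M.query
  · subst hq
    by_cases hA : qt ∈ A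
    · simp only [hA, if_true, Option.some.injEq] at h
      subst h
      exact .answerYes hA
    · simp only [hA, if_true, if_false, Option.some.injEq] at h
      subst h
      exact .answerNo hA
  · simp only [hq, if_false] at h
    obtain ⟨t, rfl, h'⟩ := Option.bind_eq_some_iff.1 h
    obtain ⟨⟨h1, h2, h3, h4⟩, h5⟩ := Option.ite_none_right_eq_some.1 h'
    obtain rfl := Option.some.inj h5
    obtain ⟨st, rfl⟩ : ∃ st', st = t.top :: st' := by
      cases st with
      | nil => simp at h4
      | cons Z st => exact ⟨st, by simpa using h4⟩
    have hm := t.mem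
    rw [h1] at hm
    cases hs : t.sym with
    | none =>
      rw [hs] at hm
      simpa [hs] using Step.lambda h2 hq hm
    | some s =>
      rw [hs] at hm
      obtain ⟨u, rfl⟩ : ∃ u', u = s :: u' := by
        cases u with
        | nil => simp [hs] at h3
        | cons Z st => exact ⟨st, by simpa [hs] using h3⟩
      simpa [hs] using Step.read h2 hq hm

theorem exists_choiceStep {c d : M.Config} (h : M.Step A c d) :
    ∃ t, M.choiceStep A t c = some d := by
  cases h with
  | @read q p s u Z v st o r out qt h1 h2 h3 =>
    refine ⟨some ⟨q, some s, Z, p, v, o, r, h3⟩, ?_⟩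
    simp [choiceStep, h1, h2]
  | @lambda q p u Z v st o r out qt h1 h2 h3 =>
    refine ⟨some ⟨q, none, Z, p, v, o, r, h3⟩, ?_⟩
    simp [choiceStep, h1, h2]
  | answerYes h => exact ⟨none, by simp [choiceStep, h]⟩
  | answerNo h => exact ⟨none, by simp [choiceStep, h]⟩

theorem reaches_of_pathOutcome {l : List (Option M.Trans)} {c : M.Config} {y : List γ}
    (h : M.pathOutcome A l c = some y) :
    ∃ d, Relation.ReflTransGen (M.Step A) c d ∧ d.state ∈ M.acc ∧ d.output = y := by
  induction l generalizing c with
  | nil =>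
    rw [pathOutcome] at h
    split_ifs at h with hc
    exact ⟨c, .refl, hc, by simpa using h⟩
  | cons t l ih =>
    rw [pathOutcome] at h
    split_ifs at h with hc
    · exact ⟨c, .refl, hc, by simpa using h⟩
    · obtain ⟨e, he, h⟩ := Option.bind_eq_some_iff.1 h
      obtain ⟨d, h1, h2⟩ := ih h
      exact ⟨d, .head (step_of_choiceStep he) h1, h2⟩

theorem not_step_of_mem_halt {c d : M.Config} (hc : c.state ∈ M.halt) : ¬ M.Step A c d := by
  intro h
  cases h with
  | read h1 => exact h1 hc
  | lambda h1 => exact h1 hc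
  | answerYes => exact M.query_not_halt hc
  | answerNo => exact M.query_not_halt hc

theorem _root_.ReachesIn.head_cases {C : Type*} {r : C → C → Prop} {t : ℕ} {c e : C}
    (h : ReachesIn r (t + 1) c e) : ∃ d, r c d ∧ ReachesIn r t d e := by
  induction t generalizing e with
  | zero =>
    cases h with
    | tail h1 h2 => cases h1; exact ⟨_, h2, .refl _⟩
  | succ t ih =>
    cases h with
    | tail h1 h2 =>
      obtain ⟨d, h3, h4⟩ := ih h1
      exact ⟨d, h3, h4.tail h2⟩

theorem _root_.ReachesIn.reflTransGen {C : Type*} {r : C → C → Prop} {t : ℕ} {c d : C}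
    (h : ReachesIn r t c d) : Relation.ReflTransGen r c d := by
  induction h with
  | refl => exact .refl
  | tail _ h ih => exact ih.tail h

theorem _root_.exists_reachesIn {C : Type*} {r : C → C → Prop} {c d : C}
    (h : Relation.ReflTransGen r c d) : ∃ t, ReachesIn r t c d := by
  induction h with
  | refl => exact ⟨0, .refl c⟩
  | tail _ h ih => exact ⟨_, ih.choose_spec.tail h⟩

/-- `pathOutcome` stops at the first accepting configuration and ignores the remaining choices, so a
shorter path can be padded to length exactly `T`. Hence lists of a single length suffice for the
search. -/
theorem exists_pathOutcome {t T : ℕ} {c d : M.Config} (h : ReachesIn (M.Step A) t c d)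
    (hd : d.state ∈ M.acc) (hT : t ≤ T) :
    ∃ l : List (Option M.Trans), l.length = T ∧ M.pathOutcome A l c = some d.output := by
  induction T generalizing t c with
  | zero =>
    obtain rfl : t = 0 := by omega
    cases h
    exact ⟨[], rfl, by simp [pathOutcome, hd]⟩
  | succ T ih =>
    cases t with
    | zero =>
      cases h
      exact ⟨List.replicate (T + 1) none, by simp, by simp [List.replicate_succ, pathOutcome, hd]⟩
    | succ t =>
      obtain ⟨e, h1, h2⟩ := h.head_cases
      obtain ⟨l, hl, hl'⟩ := ih h2 (by omega)
      obtain ⟨x, hx⟩ := exists_choiceStep h1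
      have hc : c.state ∉ M.acc := fun hc => not_step_of_mem_halt (Or.inl hc) h1
      exact ⟨x :: l, by simp [hl], by simp [pathOutcome, hc, hx, hl']⟩

end OracleNPDA

/-! ### Simulating an oracle pushdown automaton by a stack program -/

/-- Languages that are decided by stack programs with stacks of linear height. The input is pushed
on an otherwise empty store letter by letter, and at the end all stacks are empty. -/
def DecidesInLinearSpace {β : Type} (A : Language β) : Prop :=
  ∃ (ι : Type) (Γ : ι → Type) (_ : Finite ι) (_ : ∀ i, Finite (Γ i)) (P : StackProg Γ Bool)
    (i₀ : ι) (enc : β → Γ i₀) (a b : ℕ), ∀ w, ∃ r : Bool, (r = true ↔ w ∈ A) ∧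
      P.Runs ((Store.empty Γ).set i₀ (w.reverse.map enc)) r (Store.empty Γ) (a * w.length + b)

/-- The stacks of the program that searches for an accepting computation path of an oracle npda,
besides those of the program that answers the queries. -/
inductive SearchStack : Type
  /-- the input as it is given to the program -/
  | raw
  /-- the unread part of the input tape -/
  | inp
  /-- the part of the input tape that was read -/
  | inpRead
  /-- the choices to be made -/
  | choice
  /-- the choices that were made -/
  | choiceMade
  /-- the stack of the automaton -/
  | stk
  /-- the output tape of the automaton -/
  | out

instance : Finite SearchStack :=
  Finite.of_surjective (fun n : Fin 7 => ([.raw, .inp, .inpRead, .choice, .choiceMade, .stk,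
    .out] : List SearchStack).get n) (fun s => by
      cases s
      exacts [⟨0, rfl⟩, ⟨1, rfl⟩, ⟨2, rfl⟩, ⟨3, rfl⟩, ⟨4, rfl⟩, ⟨5, rfl⟩, ⟨6, rfl⟩])

namespace Search

open StackProg

variable {α β γ ι : Type}

/-! ### The stores of the search program -/

section State

variable (M : OracleNPDA α β γ) (m : ℕ) (Δ : ι → Type)

/-- The alphabets of the stacks; the choices are digits. -/
def Γ : SearchStack ⊕ ι → Type
  | .inl .raw => α
  | .inl .inp => InputSym α
  | .inl .inpRead => InputSym α
  | .inl .choice => Fin (m + 1)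
  | .inl .choiceMade => Fin (m + 1)
  | .inl .stk => M.Θ
  | .inl .out => γ
  | .inr i => Δ i

instance [Finite α] [Finite γ] [∀ i, Finite (Δ i)] : ∀ i, Finite (Γ M m Δ i)
  | .inl .raw => inferInstanceAs (Finite α)
  | .inl .inp => inferInstanceAs (Finite (InputSym α))
  | .inl .inpRead => inferInstanceAs (Finite (InputSym α))
  | .inl .choice => inferInstanceAs (Finite (Fin (m + 1)))
  | .inl .choiceMade => inferInstanceAs (Finite (Fin (m + 1)))
  | .inl .stk => M.finite_Θ
  | .inl .out => inferInstanceAs (Finite γ)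
  | .inr i => inferInstanceAs (Finite (Δ i))

/-- The stores of the search program as records. -/
structure State where
  raw : List α
  inp : List (InputSym α)
  inpRead : List (InputSym α)
  choice : List (Fin (m + 1))
  choiceMade : List (Fin (m + 1))
  stk : List M.Θ
  out : List γ
  oracle : Store Δ

variable {M m Δ}

/-- The store given by a record. -/
def State.store (s : State M m Δ) : Store (Γ M m Δ)
  | .inl .raw => s.raw
  | .inl .inp => s.inp
  | .inl .inpRead => s.inpRead
  | .inl .choice => s.choice
  | .inl .choiceMade => s.choiceMade
  | .inl .stk => s.stk
  | .inl .out => s.out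
  | .inr i => s.oracle i

/-- Allows updates of the store to be written as record updates, so that later equations between
stores reduce to equations between fields. -/
theorem store_set_eq {s s' : State M m Δ} {i : SearchStack ⊕ ι} {l : List (Γ M m Δ i)}
    (hi : s'.store i = l) (h : ∀ j, j ≠ i → s'.store j = s.store j) :
    s.store.set i l = s'.store := by
  funext j
  rcases eq_or_ne j i with rfl | hj
  · rw [Store.set_same, hi]
  · rw [Store.set_of_ne _ hj, h j hj]

theorem store_set_raw (s : State M m Δ) (l : List α) :
    s.store.set (.inl .raw) l = { s with raw := l }.store :=
  store_set_eq rfl (by rintro ((_ | _) | _) h <;> first | rfl | exact absurd rfl h)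

theorem store_set_inp (s : State M m Δ) (l : List (InputSym α)) :
    s.store.set (.inl .inp) l = { s with inp := l }.store :=
  store_set_eq rfl (by rintro ((_ | _) | _) h <;> first | rfl | exact absurd rfl h)

theorem store_set_inpRead (s : State M m Δ) (l : List (InputSym α)) :
    s.store.set (.inl .inpRead) l = { s with inpRead := l }.store :=
  store_set_eq rfl (by rintro ((_ | _) | _) h <;> first | rfl | exact absurd rfl h)

theorem store_set_choice (s : State M m Δ) (l : List (Fin (m + 1))) :
    s.store.set (.inl .choice) l = { s with choice := l }.store :=
  store_set_eq rfl (by rintro ((_ | _) | _) h <;> first | rfl | exact absurd rfl h)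

theorem store_set_choiceMade (s : State M m Δ) (l : List (Fin (m + 1))) :
    s.store.set (.inl .choiceMade) l = { s with choiceMade := l }.store :=
  store_set_eq rfl (by rintro ((_ | _) | _) h <;> first | rfl | exact absurd rfl h)

theorem store_set_stk (s : State M m Δ) (l : List M.Θ) :
    s.store.set (.inl .stk) l = { s with stk := l }.store :=
  store_set_eq rfl (by rintro ((_ | _) | _) h <;> first | rfl | exact absurd rfl h)

theorem store_set_out (s : State M m Δ) (l : List γ) :
    s.store.set (.inl .out) l = { s with out := l }.store :=
  store_set_eq rfl (by rintro ((_ | _) | _) h <;> first | rfl | exact absurd rfl h)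

theorem store_set_oracle (s : State M m Δ) (i : ι) (l : List (Δ i)) :
    s.store.set (.inr i) l = { s with oracle := s.oracle.set i l }.store :=
  store_set_eq (s.oracle.set_same i l) (by
    rintro ((_ | _) | j) h <;> first | rfl | exact s.oracle.set_of_ne (fun hj => h (congrArg Sum.inr hj)) l)

theorem fits_store {s : State M m Δ} {L : ℕ} : s.store.Fits L ↔
    s.raw.length ≤ L ∧ s.inp.length ≤ L ∧ s.inpRead.length ≤ L ∧ s.choice.length ≤ L ∧
    s.choiceMade.length ≤ L ∧ s.stk.length ≤ L ∧ s.out.length ≤ L ∧ s.oracle.Fits L := by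
  constructor
  · intro h
    exact ⟨h (.inl .raw), h (.inl .inp), h (.inl .inpRead), h (.inl .choice), h (.inl .choiceMade),
      h (.inl .stk), h (.inl .out), fun i => h (.inr i)⟩
  · rintro ⟨h1, h2, h3, h4, h5, h6, h7, h8⟩ ((_ | _) | i)
    exacts [h1, h2, h3, h4, h5, h6, h7, h8 i]

end State

/-! ### Elementary operations of the search program -/

section Basic

variable (M : OracleNPDA α β γ) (m : ℕ) (Δ : ι → Type) (i₀ : ι) (enc : β → Δ i₀)

/-- Write on the input tape. -/
def pushInp (a : InputSym α) : StackProg (Γ M m Δ) Unit := push (Sum.inl SearchStack.inp) a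

/-- Put an input symbol on the stack of symbols that were read. -/
def pushInpRead (a : InputSym α) : StackProg (Γ M m Δ) Unit := push (Sum.inl SearchStack.inpRead) a

/-- Put a choice on the stack of choices that were made. -/
def pushChoiceMade (d : Fin (m + 1)) : StackProg (Γ M m Δ) Unit := push (Sum.inl SearchStack.choiceMade) d

/-- Add choices to be made. -/
def pushChoice (l : List (Fin (m + 1))) : StackProg (Γ M m Δ) Unit := pushList (Sum.inl SearchStack.choice) l

/-- Push a word on the stack of the automaton. -/
def pushStk (v : List M.Θ) : StackProg (Γ M m Δ) Unit := pushList (Sum.inl SearchStack.stk) v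

/-- Write on the output tape. -/
def pushOut (o : Option γ) : StackProg (Γ M m Δ) Unit := pushList (Sum.inl SearchStack.out) o.toList

/-- Write on the query tape. -/
def pushQuery (r : Option β) : StackProg (Γ M m Δ) Unit :=
  pushList (Sum.inr i₀) (r.toList.map enc)

/-- The store of the oracle program, with a word on the query tape. -/
noncomputable def load (w : List β) : Store Δ := (Store.empty Δ).set i₀ (w.reverse.map enc)

variable {M m Δ i₀ enc} {s : State M m Δ} {L : ℕ}

theorem load_nil : load Δ i₀ enc [] = Store.empty Δ :=
  (Store.empty Δ).set_eq_self i₀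

theorem runs_pushInp {a : InputSym α} (hs : s.store.Fits L) (h : s.inp.length + 1 ≤ L) :
    (pushInp M m Δ a).Runs s.store () { s with inp := a :: s.inp }.store L := by
  exact (runs_push (i := Sum.inl SearchStack.inp) hs h).congr (store_set_inp s _)

theorem runs_pushInpRead {a : InputSym α} (hs : s.store.Fits L) (h : s.inpRead.length + 1 ≤ L) :
    (pushInpRead M m Δ a).Runs s.store () { s with inpRead := a :: s.inpRead }.store L := by
  exact (runs_push (i := Sum.inl SearchStack.inpRead) hs h).congr (store_set_inpRead s _)

theorem runs_pushChoiceMade {d : Fin (m + 1)} (hs : s.store.Fits L)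
    (h : s.choiceMade.length + 1 ≤ L) :
    (pushChoiceMade M m Δ d).Runs s.store () { s with choiceMade := d :: s.choiceMade }.store L := by
  exact (runs_push (i := Sum.inl SearchStack.choiceMade) hs h).congr (store_set_choiceMade s _)

theorem runs_pushChoice {l : List (Fin (m + 1))} (hs : s.store.Fits L)
    (h : l.length + s.choice.length ≤ L) :
    (pushChoice M m Δ l).Runs s.store () { s with choice := l ++ s.choice }.store L := by
  exact (runs_pushList (i := Sum.inl SearchStack.choice) l hs h).congr (store_set_choice s _)

theorem runs_pushStk {v : List M.Θ} (hs : s.store.Fits L) (h : v.length + s.stk.length ≤ L) :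
    (pushStk M m Δ v).Runs s.store () { s with stk := v ++ s.stk }.store L := by
  exact (runs_pushList (i := Sum.inl SearchStack.stk) v hs h).congr (store_set_stk s _)

/-- The output tape, like the query tape, is kept in reverse, so that writing at its right end is a
push. -/
theorem runs_pushOut {o : Option γ} {y : List γ} (hs : s.store.Fits L) (hy : s.out = y.reverse)
    (h : y.length + 1 ≤ L) :
    (pushOut M m Δ o).Runs s.store () { s with out := (y ++ o.toList).reverse }.store L := by
  have h1 : (y ++ o.toList).reverse = o.toList ++ s.out := by cases o <;> simp [hy]
  have h2 : o.toList.length ≤ 1 := by cases o <;> simp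
  have h3 : s.out.length = y.length := by simp [hy]
  rw [h1]
  exact (runs_pushList (i := Sum.inl SearchStack.out) o.toList hs (by
    change o.toList.length + s.out.length ≤ L
    omega)).congr (store_set_out s _)

theorem runs_pushQuery {r : Option β} {w : List β} (hs : s.store.Fits L)
    (hw : s.oracle = load Δ i₀ enc w) (h : w.length + 1 ≤ L) :
    (pushQuery M m Δ i₀ enc r).Runs s.store ()
      { s with oracle := load Δ i₀ enc (w ++ r.toList) }.store L := by
  have h1 : load Δ i₀ enc (w ++ r.toList) =
      s.oracle.set i₀ (r.toList.map enc ++ s.oracle i₀) := by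
    rw [hw, load, load, Store.set_set, Store.set_same]
    cases r <;> simp
  have h2 : (r.toList.map enc).length ≤ 1 := by cases r <;> simp
  have h3 : (s.oracle i₀).length = w.length := by simp [hw, load, Store.set_same]
  rw [h1]
  exact (runs_pushList (i := Sum.inr i₀) (r.toList.map enc) hs (by
    change (r.toList.map enc).length + (s.oracle i₀).length ≤ L
    omega)).congr (store_set_oracle s i₀ _)

variable (M m Δ i₀) [Finite α] [Finite γ] [∀ i, Finite (Δ i)]

/-- Read an input symbol. -/
def popInp : StackProg (Γ M m Δ) (Option (InputSym α)) := pop (Sum.inl SearchStack.inp)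

/-- Take a choice. -/
def popChoice : StackProg (Γ M m Δ) (Option (Fin (m + 1))) := pop (Sum.inl SearchStack.choice)

/-- Pop from the stack of the automaton. -/
def popStk : StackProg (Γ M m Δ) (Option M.Θ) := pop (Sum.inl SearchStack.stk)

/-- Move back the symbols that were read. -/
def rewindInp : StackProg (Γ M m Δ) Unit :=
  move (Sum.inl SearchStack.inpRead) (Sum.inl SearchStack.inp) (fun a : InputSym α => a)

/-- Move back the choices that were made, changing them by `f`. -/
def rewindChoice (f : Fin (m + 1) → Fin (m + 1)) : StackProg (Γ M m Δ) Unit :=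
  move (Sum.inl SearchStack.choiceMade) (Sum.inl SearchStack.choice) f

variable {M m Δ i₀}

theorem runs_popInp (hs : s.store.Fits L) :
    (popInp M m Δ).Runs s.store s.inp.head? { s with inp := s.inp.tail }.store L := by
  exact (runs_pop (i := Sum.inl SearchStack.inp) hs).congr (store_set_inp s _)

theorem runs_popChoice (hs : s.store.Fits L) :
    (popChoice M m Δ).Runs s.store s.choice.head? { s with choice := s.choice.tail }.store L := by
  exact (runs_pop (i := Sum.inl SearchStack.choice) hs).congr (store_set_choice s _)

theorem runs_popStk (hs : s.store.Fits L) :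
    (popStk M m Δ).Runs s.store s.stk.head? { s with stk := s.stk.tail }.store L := by
  exact (runs_pop (i := Sum.inl SearchStack.stk) hs).congr (store_set_stk s _)

theorem runs_rewindInp (hs : s.store.Fits L) (h : s.inpRead.length + s.inp.length ≤ L) :
    (rewindInp M m Δ).Runs s.store ()
      { s with inpRead := [], inp := s.inpRead.reverse ++ s.inp }.store L := by
  refine (runs_move (i := Sum.inl SearchStack.inpRead) (j := Sum.inl SearchStack.inp) (by simp) (fun a : InputSym α => a) hs h).congr ?_
  have h1 : s.inpRead.reverse ++ s.inp = (s.inpRead.map fun a => a).reverse ++ s.inp := by simp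
  rw [h1]
  exact (congrArg (fun σ : Store (Γ M m Δ) => σ.set (Sum.inl SearchStack.inp) _)
    (store_set_inpRead s [])).trans (store_set_inp _ _)

theorem runs_rewindChoice (f : Fin (m + 1) → Fin (m + 1)) (hs : s.store.Fits L)
    (h : s.choiceMade.length + s.choice.length ≤ L) :
    (rewindChoice M m Δ f).Runs s.store ()
      { s with choiceMade := [], choice := (s.choiceMade.map f).reverse ++ s.choice }.store L := by
  refine (runs_move (i := Sum.inl SearchStack.choiceMade) (j := Sum.inl SearchStack.choice) (by simp) f hs h).congr ?_
  exact (congrArg (fun σ : Store (Γ M m Δ) => σ.set (Sum.inl SearchStack.choice) _)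
    (store_set_choiceMade s [])).trans (store_set_choice _ _)

end Basic

/-! ### The exhaustive search as a stack program -/

section Program

variable (M : OracleNPDA α β γ) {m : ℕ} {Δ : ι → Type} [Finite α] [Finite γ] [∀ i, Finite (Δ i)]

open scoped Classical in
/-- Read a symbol, and check that it is the given one. -/
noncomputable def readSym (sym : Option (InputSym α)) : StackProg (Γ M m Δ) Bool :=
  sym.elim (pure _ true) fun a => (popInp M m Δ).bind fun o => o.elim (pure _ false) fun a' =>
    (pushInpRead M m Δ a').bind fun _ => pure _ (decide (a' = a))

variable (O : StackProg Δ Bool) (i₀ : ι) (enc : β → Δ i₀)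

open scoped Classical in
/-- Apply a transition, and return the new state; return `false` if it cannot be applied. -/
noncomputable def applyTrans (q : M.Q) (t : M.Trans) : StackProg (Γ M m Δ) (M.Q ⊕ Bool) :=
  haveI := M.finite_Θ
  if t.src = q ∧ q ∉ M.halt then
    (readSym M t.sym).bind fun ok =>
      bif ok then
        (popStk M m Δ).bind fun Z =>
          if Z = some t.top then
            (pushStk M m Δ t.word).bind fun _ => (pushOut M m Δ t.out).bind fun _ =>
            (pushQuery M m Δ i₀ enc t.qry).bind fun _ => pure _ (.inl t.tgt)
          else pure _ (.inr false)
      else pure _ (.inr false)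
  else pure _ (.inr false)

open scoped Classical in
/-- Perform a step, with the given choice of a transition. -/
noncomputable def performStep (q : M.Q) (t : Option M.Trans) : StackProg (Γ M m Δ) (M.Q ⊕ Bool) :=
  if q = M.query then
    (StackProg.lift (Γ := Γ M m Δ) Sum.inr O).bind fun b =>
      pure _ (.inl (bif b then M.yes else M.no))
  else t.elim (pure _ (.inr false)) fun t => applyTrans M i₀ enc q t

variable (dec : Fin (m + 1) → Option M.Trans)

open scoped Classical in
/-- Make a choice and perform a step, unless the state is accepting. -/
noncomputable def simulateStep (q : M.Q) : StackProg (Γ M m Δ) (M.Q ⊕ Bool) :=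
  if q ∈ M.acc then pure _ (.inr true)
  else (popChoice M m Δ).bind fun o => o.elim (pure _ (.inr false)) fun d =>
    (pushChoiceMade M m Δ d).bind fun _ => performStep M O i₀ enc q (dec d)

/-- Follow the computation path that is determined by the choices, and return whether it is
accepting. -/
noncomputable def simulate (q : M.Q) : StackProg (Γ M m Δ) Bool :=
  haveI := M.finite_Q
  loop (simulateStep M O i₀ enc dec) q

/-- Restore the input tape and the choices after a failed simulation, and empty the other stacks. -/
noncomputable def reset : StackProg (Γ M m Δ) Unit :=
  (clear (Sum.inl SearchStack.stk)).bind fun _ => (clear (Sum.inl SearchStack.out)).bind fun _ =>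
  (clear (Sum.inr i₀)).bind fun _ => (rewindInp M m Δ).bind fun _ => rewindChoice M m Δ fun d => d

variable (m Δ) in
/-- Replace the list of choices by the next one; return `true` if there is none. -/
noncomputable def increment : StackProg (Γ M m Δ) Bool :=
  loop (fun _ : Unit => (popChoice M m Δ).bind fun o => o.elim (pure _ (.inr true)) fun d =>
    if h : d.val + 1 < m + 1 then
      (pushChoice M m Δ [⟨d.val + 1, h⟩]).bind fun _ =>
      (rewindChoice M m Δ fun _ => 0).bind fun _ => pure _ (.inr false)
    else (pushChoiceMade M m Δ d).bind fun _ => pure _ (.inl ())) ()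

/-- Simulate the computation paths for all lists of choices, until one is accepting. -/
noncomputable def simulateAll : StackProg (Γ M m Δ) Bool :=
  loop (fun _ : Unit => (pushStk M m Δ [M.Z₀]).bind fun _ =>
    (simulate M O i₀ enc dec M.q₀).bind fun r =>
      bif r then pure _ (.inr true)
      else (reset M i₀).bind fun _ => (increment M m Δ).bind fun r =>
        pure _ (bif r then .inr false else .inl ())) ()

variable (m Δ) in
/-- Write the input tape and a list of `a * n + b` choices, where `n` is the length of the input. -/
noncomputable def prepare (a b : ℕ) : StackProg (Γ M m Δ) Unit :=
  (pushChoice M m Δ (List.replicate b 0)).bind fun _ => (pushInp M m Δ .dollar).bind fun _ =>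
  (drain (Sum.inl SearchStack.raw) fun s : α => (pushInp M m Δ (.letter s)).bind fun _ =>
    pushChoice M m Δ (List.replicate a 0)).bind fun _ =>
  pushInp M m Δ .cent

/-- Search for an accepting computation path with at most `a * n + b` steps. -/
noncomputable def search (a b : ℕ) : StackProg (Γ M m Δ) Bool :=
  (prepare M m Δ a b).bind fun _ => simulateAll M O i₀ enc dec

end Program

end Search

/-! ### Correctness of the simulation of a single path -/

namespace Search

open StackProg

variable {α β γ ι : Type}

section Correctness

variable {M : OracleNPDA α β γ} {m : ℕ} {Δ : ι → Type} {O : StackProg Δ Bool} {i₀ : ι}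
  {enc : β → Δ i₀} {dec : Fin (m + 1) → Option M.Trans} {A : Language β} {K N L : ℕ}

variable (Δ i₀ enc) in
/-- The record for a configuration of the automaton. -/
noncomputable def ofConfig (c : M.Config) (inpRead : List (InputSym α))
    (choice choiceMade : List (Fin (m + 1))) : State M m Δ :=
  ⟨[], c.input, inpRead, choice, choiceMade, c.stack, c.output.reverse,
    load Δ i₀ enc c.queryTape⟩

variable (K N L) in
/-- There is room for `n` more steps of the automaton. -/
structure Room (c : M.Config) (inpRead : List (InputSym α)) (n : ℕ) : Prop where
  stack : c.stack.length + K * n ≤ L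
  output : c.output.length + n ≤ L
  queryTape : c.queryTape.length + n ≤ N
  input : inpRead.length + c.input.length ≤ L

theorem fits_load {w : List β} (h : w.length ≤ L) : (load Δ i₀ enc w).Fits L :=
  Store.Fits.set (fun _ => Nat.zero_le _) (by simpa using h)

theorem fits_ofConfig {c : M.Config} {inpRead : List (InputSym α)}
    {choice choiceMade : List (Fin (m + 1))} {n : ℕ} (hNL : N ≤ L) (h : Room K N L c inpRead n)
    (h1 : choice.length ≤ L) (h2 : choiceMade.length ≤ L) :
    (ofConfig Δ i₀ enc c inpRead choice choiceMade).store.Fits L := by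
  obtain ⟨h3, h4, h5, h6⟩ := h
  refine fits_store.2 ⟨Nat.zero_le _, ?_, ?_, h1, h2, ?_, ?_, fits_load (by omega)⟩ <;>
    simp only [ofConfig, List.length_reverse] <;> omega

variable (M m Δ) in
/-- The record at the beginning. -/
def initial (x : List α) : State M m Δ := ⟨x.reverse, [], [], [], [], [], [], Store.empty Δ⟩

theorem store_initial (x : List α) :
    (initial M m Δ x).store = (Store.empty (Γ M m Δ)).set (.inl .raw) x.reverse := by
  have : Store.empty (Γ M m Δ) =
      (⟨[], [], [], [], [], [], [], Store.empty Δ⟩ : State M m Δ).store := by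
    funext i
    rcases i with (_ | _) | _ <;> rfl
  rw [this, store_set_raw]
  rfl

variable [Finite α] [Finite γ] [∀ i, Finite (Δ i)]

-- A wrong symbol has already been popped when it is compared, but it is saved on `inpRead` all the
-- same. So `inpRead.reverse ++ inp` survives even a failure, while `inp` alone matters only on
-- success.
open scoped Classical in
theorem runs_readSym (sym : Option (InputSym α)) {s : State M m Δ} (hs : s.store.Fits L)
    (h : s.inpRead.length + s.inp.length ≤ L) :
    ∃ (r : Bool) (inp inpRead : List (InputSym α)),
      (r = true ↔ sym = none ∨ s.inp.head? = sym) ∧ inpRead.reverse ++ inp = s.inpRead.reverse ++ s.inp ∧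
      ((sym = none ∨ s.inp.head? = sym) → inp = if sym = none then s.inp else s.inp.tail) ∧
      (readSym M sym).Runs s.store r { s with inp := inp, inpRead := inpRead }.store L := by
  cases sym with
  | none => exact ⟨true, s.inp, s.inpRead, by simp, rfl, by simp, runs_pure hs⟩
  | some a =>
    have h1 := runs_popInp hs
    cases hi : s.inp with
    | nil =>
      rw [hi] at h1
      refine ⟨false, [], s.inpRead, by simp, by simp, by simp, ?_⟩
      exact h1.bind (runs_pure h1.fits)
    | cons a' u =>
      rw [hi, List.length_cons] at h
      rw [hi] at h1
      have h2 := runs_pushInpRead (a := a') h1.fits (by simp only; omega)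
      refine ⟨decide (a' = a), u, a' :: s.inpRead, by simp, by simp, by simp, ?_⟩
      exact h1.bind (h2.bind (runs_pure h2.fits))

/-- If the transition fails halfway, `c'` is whatever was left behind: it only has to fit into the
memory and to preserve the total input, since `reset` cleans up. A step consumes one unit of room:
at most `K` cells of the stack and one cell of each write-only tape. -/
theorem exists_runs_applyTrans (hNL : N ≤ L) (hK : ∀ t : M.Trans, t.word.length ≤ K)
    {c : M.Config} (hq : c.state ≠ M.query) {inpRead : List (InputSym α)}
    {choice choiceMade : List (Fin (m + 1))} {n : ℕ} (h : Room K N L c inpRead (n + 1))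
    (h1 : choice.length ≤ L) (h2 : choiceMade.length ≤ L) (t : M.Trans) :
    ∃ c' inpRead', inpRead'.reverse ++ c'.input = inpRead.reverse ++ c.input ∧
      Room K N L c' inpRead' n ∧ ∃ r, (applyTrans M i₀ enc c.state t).Runs
        (ofConfig Δ i₀ enc c inpRead choice choiceMade).store r
        (ofConfig Δ i₀ enc c' inpRead' choice choiceMade).store L ∧
      (M.choiceStep A (some t) c = some c' ∧ r = .inl c'.state ∨
        M.choiceStep A (some t) c = none ∧ r = .inr false) := by
  classical
  have := M.finite_Θ
  have hfit : (ofConfig Δ i₀ enc c inpRead choice choiceMade).store.Fits L :=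
    fits_ofConfig hNL h h1 h2
  obtain ⟨g1, g2, g3, g4⟩ := h
  rw [mul_add, mul_one] at g1
  have hstep : M.choiceStep A (some t) c = if t.src = c.state ∧ c.state ∉ M.halt ∧
      (t.sym = none ∨ c.input.head? = t.sym) ∧ c.stack.head? = some t.top then
      some ⟨t.tgt, if t.sym = none then c.input else c.input.tail, t.word ++ c.stack.tail,
        c.output ++ t.out.toList, c.queryTape ++ t.qry.toList⟩ else none := by
    simp only [OracleNPDA.choiceStep, hq, if_false, Option.bind_some]
  unfold applyTrans
  by_cases hsrc : t.src = c.state ∧ c.state ∉ M.halt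
  · rw [if_pos hsrc]
    obtain ⟨r, inp, inpRead', hr, e1, e2, r1⟩ := runs_readSym t.sym hfit g4
    have e3 := congrArg List.length e1
    simp only [ofConfig, List.length_append, List.length_reverse] at hr e1 e2 e3
    by_cases hsym : t.sym = none ∨ c.input.head? = t.sym
    · obtain rfl := hr.2 hsym
      have r2 := runs_popStk r1.fits
      by_cases htop : c.stack.head? = some t.top
      · rw [hstep, if_pos ⟨hsrc.1, hsrc.2, hsym, htop⟩]
        rw [← e2 hsym]
        have hw := hK t
        have ht := c.stack.length_tail
        have ho : t.out.toList.length ≤ 1 := by cases t.out <;> simp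
        have hqr : t.qry.toList.length ≤ 1 := by cases t.qry <;> simp
        have r3 := runs_pushStk (v := t.word) r2.fits (by simp only [ofConfig]; omega)
        have r4 := runs_pushOut (o := t.out) (y := c.output) r3.fits rfl (by omega)
        have r5 := runs_pushQuery (r := t.qry) (w := c.queryTape) (enc := enc) r4.fits rfl
          (by omega)
        refine ⟨_, inpRead', e1, ⟨?_, ?_, ?_, ?_⟩, _, ?_, .inl ⟨rfl, rfl⟩⟩
        · simp only [List.length_append]; omega
        · simp only [List.length_append]; omega
        · simp only [List.length_append]; omega
        · simp only; omega
        · refine r1.bind ?_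
          refine r2.bind ?_
          simp only [ofConfig, htop, if_true]
          exact r3.bind (r4.bind (r5.bind (runs_pure r5.fits)))
      · rw [hstep, if_neg (fun h => htop h.2.2.2)]
        refine ⟨⟨c.state, inp, c.stack.tail, c.output, c.queryTape⟩, inpRead', e1,
          ⟨?_, ?_, ?_, ?_⟩, _, ?_, .inr ⟨rfl, rfl⟩⟩
        · simp only [List.length_tail]; omega
        · simp only; omega
        · simp only; omega
        · simp only; omega
        · refine r1.bind ?_
          refine r2.bind ?_
          simp only [ofConfig, htop, if_false]
          exact runs_pure r2.fits
    · obtain rfl : r = false := by simpa [hsym] using hr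
      rw [hstep, if_neg (fun h => hsym h.2.2.1)]
      refine ⟨⟨c.state, inp, c.stack, c.output, c.queryTape⟩, inpRead', e1,
        ⟨?_, ?_, ?_, ?_⟩, _, ?_, .inr ⟨rfl, rfl⟩⟩
      · simp only; omega
      · simp only; omega
      · simp only; omega
      · simp only; omega
      · refine r1.bind ?_
        exact runs_pure r1.fits
  · rw [if_neg hsrc, hstep, if_neg (fun h => hsrc ⟨h.1, h.2.1⟩)]
    exact ⟨c, inpRead, rfl, ⟨by omega, by omega, by omega, g4⟩, _, runs_pure hfit,
      .inr ⟨rfl, rfl⟩⟩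

/-- `Room` keeps the query tape shorter than `N`, so `hO` is needed only for such words. The oracle
program ends with all its stacks empty, which is precisely the erased query tape, ready for the next
query. -/
theorem exists_runs_performStep (hNL : N ≤ L) (hK : ∀ t : M.Trans, t.word.length ≤ K)
    (hO : ∀ w : List β, w.length ≤ N → ∃ r : Bool, (r = true ↔ w ∈ A) ∧
      O.Runs (load Δ i₀ enc w) r (Store.empty Δ) L)
    {c : M.Config} {inpRead : List (InputSym α)}
    {choice choiceMade : List (Fin (m + 1))} {n : ℕ} (h : Room K N L c inpRead (n + 1))
    (h1 : choice.length ≤ L) (h2 : choiceMade.length ≤ L) (t : Option M.Trans) :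
    ∃ c' inpRead', inpRead'.reverse ++ c'.input = inpRead.reverse ++ c.input ∧
      Room K N L c' inpRead' n ∧ ∃ r, (performStep M O i₀ enc c.state t).Runs
        (ofConfig Δ i₀ enc c inpRead choice choiceMade).store r
        (ofConfig Δ i₀ enc c' inpRead' choice choiceMade).store L ∧
      (M.choiceStep A t c = some c' ∧ r = .inl c'.state ∨
        M.choiceStep A t c = none ∧ r = .inr false) := by
  classical
  have hfit : (ofConfig Δ i₀ enc c inpRead choice choiceMade).store.Fits L :=
    fits_ofConfig hNL h h1 h2
  unfold performStep
  by_cases hq : c.state = M.query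
  · rw [if_pos hq]
    obtain ⟨g1, g2, g3, g4⟩ := h
    rw [mul_add, mul_one] at g1
    obtain ⟨r, hr, hrun⟩ := hO c.queryTape (by omega)
    have hs := fits_store.1 hfit
    have r1 := Runs.lift (Γ := Γ M m Δ) (e := Sum.inr) hrun
      (fun ρ => { ofConfig Δ i₀ enc c inpRead choice choiceMade with oracle := ρ }.store)
      (fun _ _ => rfl) (fun _ j l => store_set_oracle _ j l)
      (fun ρ hρ => fits_store.2 (by exact ⟨hs.1, hs.2.1, hs.2.2.1, hs.2.2.2.1, hs.2.2.2.2.1,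
        hs.2.2.2.2.2.1, hs.2.2.2.2.2.2.1, hρ⟩))
    have r2 := r1.congr (τ' := (ofConfig Δ i₀ enc
      ⟨if c.queryTape ∈ A then M.yes else M.no, c.input, c.stack, c.output, []⟩
      inpRead choice choiceMade).store) (congrArg (fun ρ => (⟨[], c.input, inpRead, choice, choiceMade,
        c.stack, c.output.reverse, ρ⟩ : State M m Δ).store) load_nil.symm)
    refine ⟨⟨if c.queryTape ∈ A then M.yes else M.no, c.input, c.stack, c.output, []⟩, inpRead,
      rfl, ⟨?_, ?_, ?_, ?_⟩, _, r2.bind (runs_pure r2.fits), .inl ⟨?_, ?_⟩⟩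
    · simp only; omega
    · simp only; omega
    · simp only [List.length_nil]; omega
    · exact g4
    · simp only [OracleNPDA.choiceStep, hq, if_true]
    · by_cases hA : c.queryTape ∈ A
      · simp [hA, hr.2 hA]
      · have : r = false := by simpa [hA] using hr
        simp [hA, this]
  · rw [if_neg hq]
    cases t with
    | none =>
      obtain ⟨g1, g2, g3, g4⟩ := h
      rw [mul_add, mul_one] at g1
      refine ⟨c, inpRead, rfl, ⟨by omega, by omega, by omega, g4⟩, _, runs_pure hfit,
        .inr ⟨?_, rfl⟩⟩
      simp only [OracleNPDA.choiceStep, hq, if_false, Option.bind_none]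
    | some t => exact exists_runs_applyTrans hNL hK hq h h1 h2 t

/-- Induction on the choices still to be made. Apart from the outcome, the proof keeps only what
`reset` needs: the input tape and the list of choices can be reassembled from their two halves. -/
theorem exists_runs_simulate (hNL : N ≤ L) (hK : ∀ t : M.Trans, t.word.length ≤ K)
    (hO : ∀ w : List β, w.length ≤ N → ∃ r : Bool, (r = true ↔ w ∈ A) ∧
      O.Runs (load Δ i₀ enc w) r (Store.empty Δ) L)
    (choice : List (Fin (m + 1))) {c : M.Config} {inpRead : List (InputSym α)}
    {choiceMade : List (Fin (m + 1))} (h : Room K N L c inpRead choice.length)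
    (h1 : choiceMade.length + choice.length ≤ L) :
    ∃ c' inpRead' choice' choiceMade', inpRead'.reverse ++ c'.input = inpRead.reverse ++ c.input ∧
      choiceMade'.reverse ++ choice' = choiceMade.reverse ++ choice ∧
      (simulate M O i₀ enc dec c.state).Runs
        (ofConfig Δ i₀ enc c inpRead choice choiceMade).store
        (M.pathOutcome A (choice.map dec) c).isSome
        (ofConfig Δ i₀ enc c' inpRead' choice' choiceMade').store L ∧
      ∀ y, M.pathOutcome A (choice.map dec) c = some y → c'.output = y := by
  classical
  have := M.finite_Q
  induction choice generalizing c inpRead choiceMade with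
  | nil =>
    have hfit : (ofConfig Δ i₀ enc c inpRead [] choiceMade).store.Fits L :=
      fits_ofConfig hNL h (by simp) (by omega)
    refine ⟨c, inpRead, [], choiceMade, rfl, rfl, Runs.loop_done ?_, ?_⟩
    · unfold simulateStep
      by_cases hc : c.state ∈ M.acc
      · rw [if_pos hc]
        simp only [List.map_nil, OracleNPDA.pathOutcome, if_pos hc]
        exact runs_pure hfit
      · rw [if_neg hc]
        simp only [List.map_nil, OracleNPDA.pathOutcome, if_neg hc]
        exact (runs_popChoice hfit).bind (runs_pure hfit)
    · intro y hy
      simp only [List.map_nil, OracleNPDA.pathOutcome] at hy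
      split_ifs at hy
      exact Option.some.inj hy
  | cons d choice ih =>
    rw [List.length_cons] at h h1
    have hfit : (ofConfig Δ i₀ enc c inpRead (d :: choice) choiceMade).store.Fits L :=
      fits_ofConfig hNL h (by simp; omega) (by omega)
    by_cases hc : c.state ∈ M.acc
    · refine ⟨c, inpRead, d :: choice, choiceMade, rfl, rfl, Runs.loop_done ?_, ?_⟩
      · unfold simulateStep
        rw [if_pos hc]
        simp only [List.map_cons, OracleNPDA.pathOutcome, if_pos hc]
        exact runs_pure hfit
      · intro y hy
        simp only [List.map_cons, OracleNPDA.pathOutcome, if_pos hc] at hy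
        exact Option.some.inj hy
    · have r1 := runs_popChoice hfit
      have r2 := runs_pushChoiceMade (d := d) r1.fits (by simp only [ofConfig]; omega)
      obtain ⟨c', inpRead', e1, hroom, r, r3, hr⟩ := exists_runs_performStep hNL hK hO h
        (choice := choice) (choiceMade := d :: choiceMade) (by omega) (by simp; omega) (dec d)
      have r4 : (simulateStep M O i₀ enc dec c.state).Runs
          (ofConfig Δ i₀ enc c inpRead (d :: choice) choiceMade).store r
          (ofConfig Δ i₀ enc c' inpRead' choice (d :: choiceMade)).store L := by
        unfold simulateStep
        rw [if_neg hc]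
        exact r1.bind (r2.bind r3)
      rcases hr with ⟨hr, rfl⟩ | ⟨hr, rfl⟩
      · obtain ⟨c'', inpRead'', choice'', choiceMade'', e2, e3, r5, hy⟩ :=
          ih hroom (choiceMade := d :: choiceMade) (by simp; omega)
        have e4 : M.pathOutcome A ((d :: choice).map dec) c =
            M.pathOutcome A (choice.map dec) c' := by
          simp only [List.map_cons, OracleNPDA.pathOutcome, if_neg hc, hr, Option.bind_some]
        rw [e4]
        exact ⟨c'', inpRead'', choice'', choiceMade'', e2.trans e1, by simpa using e3,
          Runs.loop_step r4 r5, hy⟩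
      · have e4 : M.pathOutcome A ((d :: choice).map dec) c = none := by
          simp only [List.map_cons, OracleNPDA.pathOutcome, if_neg hc, hr, Option.bind_none]
        rw [e4]
        exact ⟨c', inpRead', choice, d :: choiceMade, e1, by simp, Runs.loop_done r4, by simp⟩

end Correctness

end Search

/-! ### Correctness of the enumeration of all paths -/

namespace Search

open StackProg

variable {α β γ ι : Type}

section Correctness

variable {M : OracleNPDA α β γ} {m : ℕ} {Δ : ι → Type} {O : StackProg Δ Bool} {i₀ : ι}
  {enc : β → Δ i₀} {dec : Fin (m + 1) → Option M.Trans} {A : Language β} {K N L : ℕ}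
  [Finite α] [Finite γ] [∀ i, Finite (Δ i)]

/-- This is carrying: maximal digits popped so far wait on `choiceMade` and come back as zeros. An
arbitrary `choiceMade` is allowed for the sake of the induction. After an overflow the search ends,
so the final store is irrelevant. -/
theorem runs_increment {s : State M m Δ} (hs : s.store.Fits L)
    (h : s.choiceMade.length + s.choice.length ≤ L) :
    (∀ l, Odometer.succ s.choice = some l → (increment M m Δ).Runs s.store false
      { s with choiceMade := [], choice := (s.choiceMade.map fun _ => 0).reverse ++ l }.store L) ∧
    (Odometer.succ s.choice = none → ∃ τ, (increment M m Δ).Runs s.store true τ L) := by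
  have r1 := runs_popChoice hs
  induction hc : s.choice generalizing s with
  | nil =>
    rw [hc] at r1
    exact ⟨by simp [Odometer.succ], fun _ => ⟨_, Runs.loop_done (r1.bind (runs_pure r1.fits))⟩⟩
  | cons d l ih =>
    rw [hc, List.length_cons] at h
    rw [hc] at r1
    by_cases hd : d.val + 1 < m + 1
    · refine ⟨fun l' hl' => ?_, by simp [Odometer.succ, hd]⟩
      rw [Odometer.succ, dif_pos hd, Option.some.injEq] at hl'
      subst hl'
      have r2 := runs_pushChoice (l := [⟨d.val + 1, hd⟩]) r1.fits (by simp; omega)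
      have r3 := runs_rewindChoice (fun _ => 0) r2.fits (by simp; omega)
      refine Runs.loop_done (r1.bind ?_)
      simp only [List.head?_cons, Option.elim_some, dif_pos hd]
      exact r2.bind (r3.bind (runs_pure r3.fits))
    · have r2 := runs_pushChoiceMade (d := d) r1.fits (by simp; omega)
      have r3 : ((popChoice M m Δ).bind fun o => o.elim (StackProg.pure _ (.inr true)) fun d =>
          if h : d.val + 1 < m + 1 then
            (pushChoice M m Δ [⟨d.val + 1, h⟩]).bind fun _ =>
            (rewindChoice M m Δ fun _ => 0).bind fun _ => StackProg.pure _ (.inr false)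
          else (pushChoiceMade M m Δ d).bind fun _ => StackProg.pure _ (.inl ())).Runs s.store
          (Sum.inl ()) { s with choice := l, choiceMade := d :: s.choiceMade }.store L := by
        refine r1.bind ?_
        simp only [List.head?_cons, Option.elim_some, dif_neg hd]
        exact r2.bind (runs_pure r2.fits)
      obtain ⟨h1, h2⟩ := ih (s := { s with choice := l, choiceMade := d :: s.choiceMade }) r3.fits
        (by simp; omega) (runs_popChoice r3.fits) rfl
      simp only [Odometer.succ, dif_neg hd]
      refine ⟨fun l' hl' => ?_, fun hl => ?_⟩
      · obtain ⟨l'', hl'', rfl⟩ := Option.map_eq_some_iff.1 hl'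
        have h3 := h1 l'' hl''
        simp only [List.map_cons, List.reverse_cons, List.append_assoc, List.singleton_append] at h3
        exact Runs.loop_step r3 h3
      · obtain ⟨τ, h3⟩ := h2 (by simpa using hl)
        exact ⟨τ, Runs.loop_step r3 h3⟩

variable (M Δ i₀ enc) in
/-- The record before a simulation. -/
noncomputable def ready (x : List α) (choice : List (Fin (m + 1))) : State M m Δ :=
  ⟨[], inputTape x, [], choice, [], [], [], load Δ i₀ enc []⟩

theorem runs_reset {c : M.Config} {x : List α} {inpRead : List (InputSym α)}
    {l choice choiceMade : List (Fin (m + 1))}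
    (hfit : (ofConfig Δ i₀ enc c inpRead choice choiceMade).store.Fits L)
    (h1 : inpRead.reverse ++ c.input = inputTape x) (h2 : choiceMade.reverse ++ choice = l)
    (h3 : (inputTape x).length ≤ L) (h4 : l.length ≤ L) :
    (reset M i₀).Runs (ofConfig Δ i₀ enc c inpRead choice choiceMade).store ()
      (ready M Δ i₀ enc x l).store L := by
  have e1 := congrArg List.length h1
  have e2 := congrArg List.length h2
  rw [List.length_append, List.length_reverse] at e1 e2
  have e3 : (load Δ i₀ enc c.queryTape).set i₀ [] = load Δ i₀ enc [] := by
    rw [load, Store.set_set]; rfl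
  have r1 := (runs_clear (i := Sum.inl SearchStack.stk) hfit).congr (store_set_stk _ _)
  have r2 := (runs_clear (i := Sum.inl SearchStack.out) r1.fits).congr (store_set_out _ _)
  have r3 : (clear (Sum.inr i₀)).Runs _ ()
      (⟨[], c.input, inpRead, choice, choiceMade, [], [], load Δ i₀ enc []⟩ : State M m Δ).store L :=
    (runs_clear (i := Sum.inr i₀) r2.fits).congr ((store_set_oracle _ i₀ _).trans
      (congrArg (fun ρ => (⟨[], c.input, inpRead, choice, choiceMade, [], [], ρ⟩ :
        State M m Δ).store) e3))
  have r4 := runs_rewindInp r3.fits (by simp only; omega)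
  have r5 := runs_rewindChoice (fun d => d) r4.fits (by simp only; omega)
  refine (r1.bind (r2.bind (r3.bind (r4.bind r5)))).congr ?_
  simp only [ready, h1, List.map_id', h2]

/-- Strong induction on the number of lists from `choice` onwards. A negative answer excludes all
lists of at least the value of `choice`, which means all lists when the search starts from zeros. -/
theorem exists_runs_simulateAll (hNL : N ≤ L) (hK : ∀ t : M.Trans, t.word.length ≤ K)
    (hO : ∀ w : List β, w.length ≤ N → ∃ r : Bool, (r = true ↔ w ∈ A) ∧
      O.Runs (load Δ i₀ enc w) r (Store.empty Δ) L)
    {x : List α} {T : ℕ} (hroom : Room K N L (M.start x) [] T) (hT : T ≤ L)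
    (choice : List (Fin (m + 1))) (hc : choice.length = T) :
    ∃ r τ, (simulateAll M O i₀ enc dec).Runs (ready M Δ i₀ enc x choice).store r τ L ∧
      (r = true → ∃ l y, M.pathOutcome A l (M.start x) = some y ∧
        τ (.inl .out) = y.reverse) ∧
      (r = false → ∀ l : List (Fin (m + 1)), l.length = T →
        Odometer.value choice ≤ Odometer.value l →
        M.pathOutcome A (l.map dec) (M.start x) = none) := by
  have htape : (inputTape x).length ≤ L := by simpa [OracleNPDA.start] using hroom.input
  have hL : 1 ≤ L := by
    have := hroom.stack
    simp [OracleNPDA.start] at this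
    omega
  induction hv : (m + 1) ^ T - Odometer.value choice using Nat.strong_induction_on
    generalizing choice with
  | _ v ih =>
  have hfit : (ready M Δ i₀ enc x choice).store.Fits L :=
    fits_store.2 ⟨Nat.zero_le _, htape, Nat.zero_le _, hc.trans_le hT, Nat.zero_le _,
      Nat.zero_le _, Nat.zero_le _, fits_load (Nat.zero_le _)⟩
  have r1 : (pushStk M m Δ [M.Z₀]).Runs (ready M Δ i₀ enc x choice).store ()
      (ofConfig Δ i₀ enc (M.start x) [] choice []).store L :=
    runs_pushStk hfit (by simpa [ready] using hL)
  obtain ⟨c, inpRead, choice', choiceMade', e1, e2, r2, hy⟩ :=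
    exists_runs_simulate (dec := dec) hNL hK hO choice (choiceMade := []) (c := M.start x)
      (inpRead := []) (by rwa [hc]) (by simp; omega)
  cases ho : M.pathOutcome A (choice.map dec) (M.start x) with
  | some y =>
    rw [ho] at r2
    refine ⟨true, _, Runs.loop_done (r1.bind (r2.bind (runs_pure r2.fits))),
      fun _ => ⟨_, y, ho, ?_⟩, by simp⟩
    exact congrArg List.reverse (hy y ho)
  | none =>
    rw [ho] at r2
    have r3 := runs_reset (x := x) (l := choice) r2.fits e1 (by simpa using e2) htape
      (hc.trans_le hT)
    obtain ⟨h1, h2⟩ := runs_increment r3.fits (by simp [ready]; omega)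
    have hsame : ∀ l : List (Fin (m + 1)), l.length = T →
        Odometer.value l = Odometer.value choice →
        M.pathOutcome A (l.map dec) (M.start x) = none := by
      intro l hl hlv
      rw [Odometer.value_injective (hl.trans hc.symm) hlv, ho]
    cases hn : Odometer.succ choice with
    | none =>
      obtain ⟨τ, r4⟩ := h2 hn
      refine ⟨false, τ, Runs.loop_done (r1.bind (r2.bind (r3.bind (r4.bind (runs_pure r4.fits))))),
        by simp, fun _ l hl hle => hsame l hl ?_⟩
      -- `choice` has the maximal value, so a list of at least this value has the same one.
      have g1 := Odometer.value_of_succ_eq_none hn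
      have g2 := Odometer.value_lt l
      rw [hc] at g1
      rw [hl] at g2
      omega
    | some choice'' =>
      have r4 := h1 choice'' hn
      have g1 := Odometer.value_of_succ hn
      have g2 := Odometer.length_of_succ hn
      have g3 := Odometer.value_lt choice''
      rw [hc] at g2
      rw [g2] at g3
      obtain ⟨r, τ, r5, h5, h6⟩ := ih _ (by omega) choice'' g2 rfl
      refine ⟨r, τ, Runs.loop_step (r1.bind (r2.bind (r3.bind (r4.bind (runs_pure r4.fits))))) r5,
        h5, fun hr l hl hle => ?_⟩
      rcases hle.eq_or_lt with he | hlt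
      · exact hsame l hl he.symm
      · exact h6 hr l hl (by omega)

/-- The input stack has the last letter on top, so transferring it brings the first letter to the
top of `inp`. Every letter brings `a` choices with it, which produces `a * n` of them without
computing a length. -/
theorem runs_drain_raw (a : ℕ) {s : State M m Δ} (hs : s.store.Fits L)
    (h1 : s.raw.length + s.inp.length ≤ L) (h2 : a * s.raw.length + s.choice.length ≤ L) :
    (drain (Sum.inl SearchStack.raw) fun b : α => (pushInp M m Δ (.letter b)).bind fun _ =>
      pushChoice M m Δ (List.replicate a 0)).Runs s.store ()
      { s with
        raw := []
        inp := (s.raw.map InputSym.letter).reverse ++ s.inp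
        choice := List.replicate (a * s.raw.length) 0 ++ s.choice }.store L := by
  induction hr : s.raw generalizing s with
  | nil =>
    refine (runs_drain_nil (i := Sum.inl SearchStack.raw) hs hr).congr ?_
    obtain ⟨raw, inp, inpRead, choice, choiceMade, stk, out, oracle⟩ := s
    subst hr
    simp
  | cons b l ih =>
    rw [hr, List.length_cons] at h1 h2
    rw [mul_add, mul_one] at h2
    have r0 : ({ s with raw := l } : State M m Δ).store.Fits L :=
      fits_store.2 ⟨by simp only; omega, (fits_store.1 hs).2⟩
    have r1 := runs_pushInp (a := .letter b) r0 (by simp only; omega)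
    have r2 := runs_pushChoice (l := List.replicate a 0) r1.fits (by simp; omega)
    have r3 := ih r2.fits (by simp; omega) (by simp; omega) rfl
    refine runs_drain_cons (i := Sum.inl SearchStack.raw) hs hr (by
      rw [store_set_raw]
      exact r1.bind r2) (r3.congr ?_)
    simp only [List.map_cons, List.reverse_cons, List.append_assoc, List.singleton_append,
      List.length_cons, mul_add, mul_one, List.replicate_add]

theorem runs_prepare {a b : ℕ} {x : List α} (h1 : x.length + 2 ≤ L)
    (h2 : a * x.length + b ≤ L) :
    (prepare M m Δ a b).Runs (initial M m Δ x).store ()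
      (ready M Δ i₀ enc x (List.replicate (a * x.length + b) 0)).store L := by
  have hfit : (initial M m Δ x).store.Fits L :=
    fits_store.2 ⟨by simp [initial]; omega, Nat.zero_le _, Nat.zero_le _, Nat.zero_le _,
      Nat.zero_le _, Nat.zero_le _, Nat.zero_le _, fun _ => Nat.zero_le _⟩
  have r1 := runs_pushChoice (l := List.replicate b 0) hfit (by simp [initial]; omega)
  have r2 := runs_pushInp (a := .dollar) r1.fits (by simp [initial]; omega)
  have r3 := runs_drain_raw a r2.fits (by simp [initial]; omega) (by simp [initial]; omega)
  have r4 := runs_pushInp (a := .cent) r3.fits (by simp [initial]; omega)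
  refine (r1.bind (r2.bind (r3.bind r4))).congr ?_
  simp only [initial, ready, load_nil, inputTape, List.length_reverse, List.map_reverse,
    List.reverse_reverse, List.append_nil, List.replicate_add]

end Correctness

/-- An accepting computation path of at most `a * n + b` steps of an oracle npda, whose oracle is
decided in linear space, can be found in linear space. -/
theorem exists_stackProg [Finite α] [Finite γ] (M : OracleNPDA α β γ) {A : Language β}
    (hA : DecidesInLinearSpace A) (a b : ℕ) :
    ∃ (ι : Type) (Γ : ι → Type) (_ : Finite ι) (_ : ∀ i, Finite (Γ i)) (P : StackProg Γ Bool)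
      (i₁ i₂ : ι) (enc : α → Γ i₁) (dec : γ → Γ i₂) (a' b' : ℕ),
      Function.Injective enc ∧ Function.Injective dec ∧ ∀ x, ∃ r τ,
        P.Runs ((Store.empty Γ).set i₁ (x.reverse.map enc)) r τ (a' * x.length + b') ∧
        (r = true → ∃ y ∈ M.outcomes A x, τ i₂ = y.reverse.map dec) ∧
        (r = false → ∀ t ≤ a * x.length + b, ∀ c, ReachesIn (M.Step A) t (M.start x) c →
          c.state ∉ M.acc) := by
  obtain ⟨ι, Δ, _, _, O, i₀, enc, a₀, b₀, hO⟩ := hA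
  obtain ⟨n, ⟨e⟩⟩ := Finite.exists_equiv_fin (Option M.Trans)
  obtain ⟨m, rfl⟩ : ∃ m, n = m + 1 := Nat.exists_eq_succ_of_ne_zero (by
    rintro rfl
    exact (e none).elim0)
  obtain ⟨K, hK⟩ : ∃ K, ∀ t : M.Trans, t.word.length ≤ K := by
    obtain ⟨K, hK⟩ := (Set.finite_range fun t : M.Trans => t.word.length).bddAbove
    exact ⟨K, fun t => hK ⟨t, rfl⟩⟩
  -- With `T = a * n + b`, the common bound must cover `K * T + 1` for the stack of the automaton,
  -- `T` each for choices and output, `a₀ * T + b₀` for the oracle program, and `n + 2` for the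
  -- input with its endmarkers. The two coefficients come from expanding the sum of these in `n`.
  refine ⟨SearchStack ⊕ ι, Γ M m Δ, inferInstance, inferInstance, search M O i₀ enc e.symm a b,
    .inl .raw, .inl .out, fun s => s, fun s => s, K * a + a + a₀ * a + 1,
    K * b + b + (a₀ * b + b₀) + 2, fun _ _ h => h, fun _ _ h => h, fun x => ?_⟩
  set T := a * x.length + b with hT
  have hL : (K * a + a + a₀ * a + 1) * x.length + (K * b + b + (a₀ * b + b₀) + 2) =
      K * T + T + (a₀ * T + b₀) + x.length + 2 := by
    rw [hT]; ring
  rw [hL]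
  set L := K * T + T + (a₀ * T + b₀) + x.length + 2 with hL'
  have hO' : ∀ w : List β, w.length ≤ T → ∃ r : Bool, (r = true ↔ w ∈ A) ∧
      O.Runs (load Δ i₀ enc w) r (Store.empty Δ) L := by
    intro w hw
    obtain ⟨r, hr, hrun⟩ := hO w
    have := Nat.mul_le_mul_left a₀ hw
    exact ⟨r, hr, hrun.mono (by omega)⟩
  have hroom : Room K T L (M.start x) [] T := by
    constructor <;> simp [OracleNPDA.start, inputTape] <;> omega
  have r1 := runs_prepare (M := M) (m := m) (i₀ := i₀) (enc := enc) (L := L) (a := a) (b := b)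
    (x := x) (by omega) (by omega)
  obtain ⟨r, τ, r2, h1, h2⟩ := exists_runs_simulateAll (dec := e.symm) (by omega) hK hO' hroom
    (by omega) (List.replicate T 0) (by simp)
  refine ⟨r, τ, ?_, fun hr => ?_, fun hr t ht c hc hacc => ?_⟩
  · have r3 := r1.bind r2
    rw [store_initial] at r3
    have e1 : x.reverse.map (fun s => s) = x.reverse := List.map_id' _
    exact e1.symm ▸ r3
  · obtain ⟨l, y, hy, hτ⟩ := h1 hr
    exact ⟨y, OracleNPDA.reaches_of_pathOutcome hy, hτ.trans (List.map_id' _).symm⟩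
  · obtain ⟨l, hl, hl'⟩ := OracleNPDA.exists_pathOutcome hc hacc ht
    have h3 := h2 hr (l.map e) (by simpa using hl) (by
      rw [Odometer.value_replicate_zero]
      exact Nat.zero_le _)
    simp [Function.comp_def, hl'] at h3

end Search

/-! ### Languages and functions computed with an oracle that is decided in linear space -/

theorem DecidesInLinearSpace.compl {β : Type} {A : Language β} (hA : DecidesInLinearSpace A) :
    DecidesInLinearSpace Aᶜ := by
  obtain ⟨ι, Γ, h1, h2, P, i₀, enc, a, b, h⟩ := hA
  refine ⟨ι, Γ, h1, h2, P.bind fun r => StackProg.pure Γ (!r), i₀, enc, a, b, fun w => ?_⟩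
  obtain ⟨r, hr, hrun⟩ := h w
  refine ⟨!r, ?_, hrun.bind (StackProg.runs_pure hrun.fits)⟩
  rw [Bool.not_eq_true', ← Bool.not_eq_true, hr]
  rfl

/-- A dummy oracle for automata that make no queries; over `Empty` the only word is `[]`. -/
theorem decidesInLinearSpace_empty : DecidesInLinearSpace (∅ : Set (List Empty)) := by
  refine ⟨Unit, fun _ => Empty, inferInstance, inferInstance, StackProg.pure _ false, (),
    fun s => s, 0, 0, fun w => ⟨false, by simp; exact fun h => h, ?_⟩⟩
  obtain rfl : w = [] := List.eq_nil_iff_forall_not_mem.2 fun s => s.elim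
  exact (StackProg.runs_pure (Store.Fits.set (fun _ => le_rfl) (by simp))).congr
    (Store.set_eq_self (Store.empty fun _ : Unit => Empty) ())

/-- Termination of `M` is not assumed: any accepting path proves membership, and members only need
one short accepting path. The automata of grammars, which may run forever, require this generality.
The final `clearAll` makes the decider reusable as an oracle. -/
theorem DecidesInLinearSpace.of_oracleNPDA {α β γ : Type} [Finite α] [Finite γ]
    (M : OracleNPDA α β γ) {A : Language β} (hA : DecidesInLinearSpace A) (a b : ℕ)
    {S : Language α} (h1 : ∀ x, M.Accepts A x → x ∈ S)
    (h2 : ∀ x ∈ S, ∃ t ≤ a * x.length + b, ∃ c, ReachesIn (M.Step A) t (M.start x) c ∧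
      c.state ∈ M.acc) : DecidesInLinearSpace S := by
  obtain ⟨ι, Γ, _, _, P, i₁, i₂, enc, dec, a', b', -, -, h⟩ := Search.exists_stackProg M hA a b
  refine ⟨ι, Γ, ‹_›, ‹_›, P.bind fun r => (StackProg.clearAll Γ).bind fun _ => StackProg.pure Γ r,
    i₁, enc, a', b', fun x => ?_⟩
  obtain ⟨r, τ, hrun, ht, hf⟩ := h x
  have hclear := StackProg.runs_clearAll hrun.fits
  refine ⟨r, ⟨fun hr => ?_, fun hx => ?_⟩,
    hrun.bind (hclear.bind (StackProg.runs_pure hclear.fits))⟩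
  · obtain ⟨y, ⟨c, hc, hacc, -⟩, -⟩ := ht hr
    exact h1 x ⟨c, hc, hacc⟩
  · by_contra hr
    obtain ⟨t, htle, c, hc, hacc⟩ := h2 x hx
    exact hf (by simpa using hr) t htle c hc hacc

/-- Totality excludes a failed search, and single-valuedness makes any accepting path as good as
another. -/
theorem exists_multiTapeTM_of_oracleNPDA {α β γ : Type} [Finite α] [Finite γ]
    (M : OracleNPDA α β γ) {A : Language β} (hA : DecidesInLinearSpace A) (a b : ℕ)
    {f : List α → Set (List γ)} (hf : ∀ x, f x = M.outcomes A x)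
    (hsv : ∀ x, (f x).Subsingleton) (htot : ∀ x, (f x).Nonempty)
    (h : ∀ x t c, ReachesIn (M.Step A) t (M.start x) c → t ≤ a * x.length + b) :
    ∃ N : MultiTapeTM α γ, N.LinearSpace ∧ N.Computes f := by
  obtain ⟨ι, Γ, _, _, P, i₁, i₂, enc, dec, a', b', henc, hdec, hP⟩ :=
    Search.exists_stackProg M hA a b
  have key : ∀ x, ∃ y, f x = {y} ∧ (P.toTM i₁ i₂ enc henc dec hdec).Outputs x y ∧
      ∀ i, ((P.toTM i₁ i₂ enc henc dec hdec).scanned x i).encard ≤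
        (a' * x.length + b' + 2 : ℕ) := by
    intro x
    obtain ⟨r, τ, hrun, ht, hfalse⟩ := hP x
    have hr : r = true := by
      by_contra hr
      obtain ⟨y, hy⟩ := htot x
      rw [hf] at hy
      obtain ⟨c, hc, hacc, -⟩ := hy
      obtain ⟨t, hc⟩ := exists_reachesIn hc
      exact hfalse (by simpa using hr) t (h x t c hc) c hc hacc
    obtain ⟨y, hy, hτ⟩ := ht hr
    rw [← hf] at hy
    exact ⟨y, (hsv x).eq_singleton_of_mem hy, P.toTM_outputs i₁ i₂ enc henc dec hdec hrun hτ⟩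
  refine ⟨P.toTM i₁ i₂ enc henc dec hdec, ⟨a', b' + 2, fun x i => ?_⟩, fun x => ?_⟩
  · obtain ⟨y, -, -, h⟩ := key x
    exact h i
  · obtain ⟨y, h1, h2, -⟩ := key x
    exact ⟨y, h1, h2⟩

/-! ### Pushdown automata as oracle pushdown automata -/

namespace NPDA

variable {α γ : Type}

/-- An npda, viewed as an oracle npda that makes no queries. -/
def toOracle (N : NPDA α (Option γ)) : OracleNPDA α Empty γ where
  Q := N.Q ⊕ Option Bool
  Θ := N.Θ
  finite_Q := by
    have := N.finite_Q
    infer_instance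
  finite_Θ := N.finite_Θ
  δ q s Z := Sum.elim (fun q => (fun r => (Sum.inl r.1, r.2.1, r.2.2, none)) '' N.δ q s Z)
    (fun _ => ∅) q
  finite_δ q s Z := by
    cases q with
    | inl q => exact (N.finite_δ q s Z).image _
    | inr _ => exact Set.finite_empty
  q₀ := .inl N.q₀
  Z₀ := N.Z₀
  acc := Sum.inl '' N.acc
  rej := Sum.inl '' N.rej
  disjoint_acc_rej := (Set.disjoint_image_iff Sum.inl_injective).2 N.disjoint_acc_rej
  query := .inr none
  yes := .inr (some true)
  no := .inr (some false)
  query_not_halt := by simp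
  query_ne_yes := by simp
  query_ne_no := by simp
  yes_ne_no := by simp

/-- The configuration of `N.toOracle` for a configuration of `N`. -/
def Config.toOracle {N : NPDA α (Option γ)} (c : N.Config) : N.toOracle.Config :=
  ⟨.inl c.state, c.input, c.stack, c.output, []⟩

variable {N : NPDA α (Option γ)} {A : Language Empty}

theorem inl_mem_halt_toOracle {q : N.Q} :
    (Sum.inl q : N.toOracle.Q) ∈ N.toOracle.halt ↔ q ∈ N.halt :=
  or_congr Sum.inl_injective.mem_set_image Sum.inl_injective.mem_set_image

theorem Step.toOracle {c d : N.Config} (h : N.Step c d) :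
    N.toOracle.Step A c.toOracle d.toOracle := by
  cases h with
  | @read q p s u Z v st o out h1 h2 =>
    exact OracleNPDA.Step.read (M := N.toOracle) (q := .inl q) (p := .inl p) (r := none) (qt := [])
      (mt inl_mem_halt_toOracle.1 h1) Sum.inl_ne_inr ⟨_, h2, rfl⟩
  | @lambda q p u Z v st o out h1 h2 =>
    exact OracleNPDA.Step.lambda (M := N.toOracle) (q := .inl q) (p := .inl p) (r := none)
      (qt := []) (mt inl_mem_halt_toOracle.1 h1) Sum.inl_ne_inr ⟨_, h2, rfl⟩

/-- All transitions of `N.toOracle` lead into the left summand, so the query state in the right one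
is never entered and `A` plays no role. -/
theorem exists_step_of_toOracle {c : N.Config} {d' : N.toOracle.Config}
    (h : N.toOracle.Step A c.toOracle d') : ∃ d : N.Config, d' = d.toOracle ∧ N.Step c d := by
  obtain ⟨q, u, st, out⟩ := c
  generalize hc : Config.toOracle (N := N) ⟨q, u, st, out⟩ = c' at h
  cases h with
  | @read q' p s u Z v st o r out qt h1 h2 h3 =>
    cases hc
    obtain ⟨⟨p', v', o'⟩, h4, h5⟩ := h3
    cases h5
    exact ⟨_, rfl, Step.read (mt inl_mem_halt_toOracle.2 h1) h4⟩
  | @lambda q' p u Z v st o r out qt h1 h2 h3 =>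
    cases hc
    obtain ⟨⟨p', v', o'⟩, h4, h5⟩ := h3
    cases h5
    exact ⟨_, rfl, Step.lambda (mt inl_mem_halt_toOracle.2 h1) h4⟩
  | answerYes => cases hc
  | answerNo => cases hc

theorem reachesIn_toOracle {t : ℕ} {c d : N.Config} (h : ReachesIn N.Step t c d) :
    ReachesIn (N.toOracle.Step A) t c.toOracle d.toOracle := by
  induction h with
  | refl => exact .refl _
  | tail _ h ih => exact ih.tail h.toOracle

theorem exists_reachesIn_of_toOracle {t : ℕ} {c : N.Config} {d' : N.toOracle.Config}
    (h : ReachesIn (N.toOracle.Step A) t c.toOracle d') :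
    ∃ d : N.Config, d' = d.toOracle ∧ ReachesIn N.Step t c d := by
  generalize hc : c.toOracle = c' at h
  induction h with
  | refl => exact ⟨c, hc.symm, .refl c⟩
  | tail _ h ih =>
    obtain ⟨d, rfl, hd⟩ := ih hc
    obtain ⟨e, rfl, he⟩ := exists_step_of_toOracle h
    exact ⟨e, rfl, hd.tail he⟩

theorem state_toOracle_mem_acc {c : N.Config} :
    c.toOracle.state ∈ N.toOracle.acc ↔ c.state ∈ N.acc :=
  Sum.inl_injective.mem_set_image

theorem outcomes_toOracle (x : List α) : N.toOracle.outcomes A x = N.outcomes x := by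
  ext y
  constructor
  · rintro ⟨c', hc, hacc, rfl⟩
    obtain ⟨t, hc⟩ := exists_reachesIn hc
    obtain ⟨c, rfl, hc'⟩ := exists_reachesIn_of_toOracle (c := N.start x) hc
    exact ⟨c, hc'.reflTransGen, state_toOracle_mem_acc.1 hacc, rfl⟩
  · rintro ⟨c, hc, hacc, rfl⟩
    obtain ⟨t, hc⟩ := exists_reachesIn hc
    exact ⟨c.toOracle, (reachesIn_toOracle hc).reflTransGen, state_toOracle_mem_acc.2 hacc, rfl⟩

end NPDA

/-! ### Short derivations in context-free grammars -/

namespace ContextFreeGrammar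

variable {T : Type} {g : ContextFreeGrammar T}

variable (g) in
/-- `g.Gen n s w`: there is a leftmost derivation of `w` from the string `s` with `n` steps. -/
inductive Gen : ℕ → List (Symbol T g.NT) → List T → Prop
  | nil : Gen 0 [] []
  | terminal {n : ℕ} {s : List (Symbol T g.NT)} {w : List T} (a : T) :
      Gen n s w → Gen n (.terminal a :: s) (a :: w)
  | rule {n : ℕ} {s : List (Symbol T g.NT)} {w : List T} (r : ContextFreeRule T g.NT) :
      r ∈ g.rules → Gen n (r.output ++ s) w → Gen (n + 1) (.nonterminal r.input :: s) w

theorem Gen.append {n n' : ℕ} {s s' : List (Symbol T g.NT)} {w w' : List T} (h : g.Gen n s w)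
    (h' : g.Gen n' s' w') : g.Gen (n + n') (s ++ s') (w ++ w') := by
  induction h with
  | nil => simpa using h'
  | terminal a _ ih => exact .terminal a ih
  | rule r hr _ ih =>
    rw [Nat.add_right_comm]
    exact .rule r hr (by simpa using ih)

/-- A leftmost derivation finishes with `s` before it touches `s'`, so it can be cut there, and the
numbers of steps add up. -/
theorem Gen.split {n : ℕ} {s s' : List (Symbol T g.NT)} {w : List T} (h : g.Gen n (s ++ s') w) :
    ∃ n₁ n₂ w₁ w₂, n = n₁ + n₂ ∧ w = w₁ ++ w₂ ∧ g.Gen n₁ s w₁ ∧ g.Gen n₂ s' w₂ := by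
  generalize hu : s ++ s' = u at h
  induction h generalizing s with
  | nil =>
    obtain ⟨rfl, rfl⟩ := List.append_eq_nil_iff.1 hu
    exact ⟨0, 0, [], [], rfl, rfl, .nil, .nil⟩
  | @terminal n u w a h ih =>
    cases s with
    | nil =>
      subst hu
      exact ⟨0, n, [], a :: w, by simp, rfl, .nil, .terminal a h⟩
    | cons x s =>
      obtain ⟨rfl, rfl⟩ := List.cons.inj hu
      obtain ⟨n₁, n₂, w₁, w₂, rfl, rfl, h1, h2⟩ := ih rfl
      exact ⟨n₁, n₂, a :: w₁, w₂, rfl, rfl, .terminal a h1, h2⟩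
  | @rule n u w r hr h ih =>
    cases s with
    | nil =>
      subst hu
      exact ⟨0, n + 1, [], w, by simp, rfl, .nil, .rule r hr h⟩
    | cons x s =>
      obtain ⟨rfl, rfl⟩ := List.cons.inj hu
      obtain ⟨n₁, n₂, w₁, w₂, rfl, rfl, h1, h2⟩ := ih (s := r.output ++ s) (by simp)
      exact ⟨n₁ + 1, n₂, w₁, w₂, by omega, rfl, .rule r hr h1, h2⟩

theorem gen_terminals (w : List T) : g.Gen 0 (w.map .terminal) w := by
  induction w with
  | nil => exact .nil
  | cons a w ih => exact .terminal a ih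

theorem Gen.derives {n : ℕ} {s : List (Symbol T g.NT)} {w : List T} (h : g.Gen n s w) :
    g.Derives s (w.map .terminal) := by
  induction h with
  | nil => exact .refl _
  | terminal a _ ih => exact ih.append_left [.terminal a]
  | rule r hr _ ih => exact Produces.trans_derives ⟨r, hr, .head _⟩ ih

/-- The order of rewriting is immaterial: to prepend a rule application at any position, split the
leftmost derivation there, insert one `rule` step and reassemble. -/
theorem exists_gen_of_derives {s : List (Symbol T g.NT)} {w : List T}
    (h : g.Derives s (w.map .terminal)) : ∃ n, g.Gen n s w := by
  induction h using Relation.ReflTransGen.head_induction_on with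
  | refl => exact ⟨0, gen_terminals w⟩
  | head h _ ih =>
    obtain ⟨r, hr, h⟩ := h
    obtain ⟨n, hn⟩ := ih
    obtain ⟨p, q, rfl, rfl⟩ := h.exists_parts
    rw [List.append_assoc] at hn ⊢
    obtain ⟨n₁, n₂, w₁, w₂, rfl, rfl, h1, h2⟩ := hn.split
    exact ⟨_, h1.append (.rule r hr h2)⟩

theorem mem_language_iff_gen {w : List T} :
    w ∈ g.language ↔ ∃ n, g.Gen n [.nonterminal g.initial] w :=
  ⟨exists_gen_of_derives, fun ⟨_, h⟩ => h.derives⟩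

/-- `g.Chain c A B`: a derivation from `B` gives a derivation from `A` of the same word with at most
`c` more steps. -/
def Chain (g : ContextFreeGrammar T) (c : ℕ) (A B : g.NT) : Prop :=
  ∀ n w, g.Gen n [.nonterminal B] w → ∃ n' ≤ n + c, g.Gen n' [.nonterminal A] w

theorem exists_rule_of_gen {n : ℕ} {A : g.NT} {w : List T} (h : g.Gen n [.nonterminal A] w) :
    ∃ r ∈ g.rules, r.input = A ∧ ∃ n', n = n' + 1 ∧ g.Gen n' r.output w := by
  cases h with
  | rule r hr h => exact ⟨r, hr, rfl, _, rfl, by simpa using h⟩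

/-- A derivation of a nonempty word from a string either derives the whole word from a single
symbol, or splits into two derivations of nonempty words. -/
theorem Gen.single_or_split {n : ℕ} {s : List (Symbol T g.NT)} {w : List T} (h : g.Gen n s w)
    (hw : w ≠ []) :
    (∃ u X v n₁ n₂ n₃, s = u ++ X :: v ∧ n = n₁ + n₂ + n₃ ∧ g.Gen n₁ u [] ∧ g.Gen n₂ [X] w ∧
      g.Gen n₃ v []) ∨
    ∃ u v n₁ n₂ w₁ w₂, s = u ++ v ∧ w = w₁ ++ w₂ ∧ w₁ ≠ [] ∧ w₂ ≠ [] ∧ g.Gen n₁ u w₁ ∧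
      g.Gen n₂ v w₂ := by
  induction s generalizing n w with
  | nil => cases h; exact absurd rfl hw
  | cons X s ih =>
    obtain ⟨n₁, n₂, w₁, w₂, rfl, rfl, h1, h2⟩ := Gen.split (s := [X]) h
    by_cases hw1 : w₁ = []
    · subst hw1
      rw [List.nil_append] at hw ⊢
      rcases ih h2 hw with ⟨u, Y, v, k₁, k₂, k₃, rfl, rfl, g1, g2, g3⟩ |
        ⟨u, v, k₁, k₂, w₁, w₂, rfl, rfl, e1, e2, g1, g2⟩
      · exact .inl ⟨X :: u, Y, v, n₁ + k₁, k₂, k₃, rfl, by omega, h1.append g1, g2, g3⟩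
      · exact .inr ⟨X :: u, v, n₁ + k₁, k₂, w₁, w₂, rfl, rfl, e1, e2, h1.append g1, g2⟩
    · by_cases hw2 : w₂ = []
      · subst hw2
        rw [List.append_nil]
        exact .inl ⟨[], X, s, 0, n₁, n₂, rfl, by omega, .nil, h1, h2⟩
      · exact .inr ⟨[X], s, n₁, n₂, w₁, w₂, rfl, rfl, hw1, hw2, h1, h2⟩

/-- If every nonterminal that derives a word from a class has a derivation of it that is short, then
so does every string. -/
theorem exists_gen_le_of_forall {E K ℓ : ℕ}
    (hE : ∀ A n, g.Gen n [.nonterminal A] [] → ∃ n' ≤ E, g.Gen n' [.nonterminal A] [])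
    (hK : ∀ A n w, w ≠ [] → w.length ≤ ℓ → g.Gen n [.nonterminal A] w →
      ∃ n' ≤ K * (2 * w.length - 1), g.Gen n' [.nonterminal A] w)
    {s : List (Symbol T g.NT)} {w : List T} (hw : w.length ≤ ℓ) {n : ℕ} (h : g.Gen n s w) :
    ∃ n' ≤ s.length * E + K * (2 * w.length - 1), g.Gen n' s w := by
  induction s generalizing n w with
  | nil => exact ⟨0, Nat.zero_le _, by cases h; exact .nil⟩
  | cons X s ih =>
    obtain ⟨n₁, n₂, w₁, w₂, rfl, rfl, h1, h2⟩ := Gen.split (s := [X]) h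
    rw [List.length_append] at hw
    obtain ⟨k₂, hk₂, g2⟩ := ih (by omega) h2
    have hX : ∃ k₁ ≤ E + K * (2 * w₁.length - 1), g.Gen k₁ [X] w₁ := by
      cases X with
      | terminal a =>
        cases h1 with
        | terminal a h1 => cases h1; exact ⟨0, Nat.zero_le _, .terminal a .nil⟩
      | nonterminal A =>
        by_cases hw1 : w₁ = []
        · subst hw1
          obtain ⟨k, hk, hg⟩ := hE A _ h1
          exact ⟨k, by omega, hg⟩
        · obtain ⟨k, hk, hg⟩ := hK A _ w₁ hw1 (by omega) h1
          exact ⟨k, by omega, hg⟩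
    obtain ⟨k₁, hk₁, g1⟩ := hX
    refine ⟨k₁ + k₂, ?_, g1.append g2⟩
    have : K * (2 * w₁.length - 1) + K * (2 * w₂.length - 1) ≤
        K * (2 * (w₁ ++ w₂).length - 1) := by
      rw [← mul_add, List.length_append]
      exact Nat.mul_le_mul_left K (by omega)
    rw [List.length_cons, add_mul, one_mul]
    omega

/-- The type of nonterminals may be infinite, but only the left-hand sides of rules derive a word.
One erasing derivation is chosen for each of these, and `E` is the maximum. -/
theorem exists_bound_empty (g : ContextFreeGrammar T) :
    ∃ E, ∀ A n, g.Gen n [.nonterminal A] [] → ∃ n' ≤ E, g.Gen n' [.nonterminal A] [] := by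
  classical
  have h : ∀ A : g.NT, ∃ E, ∀ n, g.Gen n [.nonterminal A] [] →
      ∃ n' ≤ E, g.Gen n' [.nonterminal A] [] := by
    intro A
    by_cases h : ∃ n, g.Gen n [.nonterminal A] []
    · obtain ⟨n, hn⟩ := h
      exact ⟨n, fun _ _ => ⟨n, le_rfl, hn⟩⟩
    · exact ⟨0, fun n hn => absurd ⟨n, hn⟩ h⟩
  choose E hE using h
  refine ⟨(g.rules.image ContextFreeRule.input).sup E, fun A n hn => ?_⟩
  obtain ⟨n', hn', hg⟩ := hE A n hn
  obtain ⟨r, hr, rfl, -⟩ := exists_rule_of_gen hn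
  exact ⟨n', hn'.trans (Finset.le_sup (Finset.mem_image_of_mem _ hr)), hg⟩

/-- This replaces the removal of cycles from chains: wherever a chain exists at all, one of cost at
most `N` exists, since there are only finitely many pairs of rules. -/
theorem exists_bound_chain (g : ContextFreeGrammar T) :
    ∃ N, ∀ r ∈ g.rules, ∀ r' ∈ g.rules, (∃ c, g.Chain c r.input r'.input) →
      g.Chain N r.input r'.input := by
  classical
  have h : ∀ p : ContextFreeRule T g.NT × ContextFreeRule T g.NT, ∃ N,
      (∃ c, g.Chain c p.1.input p.2.input) → g.Chain N p.1.input p.2.input := by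
    intro p
    by_cases h : ∃ c, g.Chain c p.1.input p.2.input
    · exact ⟨h.choose, fun _ => h.choose_spec⟩
    · exact ⟨0, fun h' => absurd h' h⟩
  choose N hN using h
  refine ⟨(g.rules ×ˢ g.rules).sup N, fun r hr r' hr' h n w hw => ?_⟩
  obtain ⟨n', hn', hg⟩ := hN (r, r') h n w hw
  have := Finset.le_sup (f := N) (Finset.mk_mem_product hr hr')
  exact ⟨n', by omega, hg⟩

/-- The words of length `n` in the language of a context-free grammar have derivations of length
`O(n)`. -/
theorem exists_short_gen (g : ContextFreeGrammar T) : ∃ a b, ∀ A n w, g.Gen n [.nonterminal A] w →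
    ∃ n' ≤ a * w.length + b, g.Gen n' [.nonterminal A] w := by
  obtain ⟨E, hE⟩ := exists_bound_empty g
  obtain ⟨N, hN⟩ := exists_bound_chain g
  obtain ⟨m, hm⟩ : ∃ m, ∀ r ∈ g.rules, r.output.length ≤ m :=
    ⟨g.rules.sup fun r => r.output.length,
      fun r hr => Finset.le_sup (f := fun r : ContextFreeRule T g.NT => r.output.length) hr⟩
  -- A branching costs at most a chain (`N`), one rule, and the erased symbols on its right-hand
  -- side (`m * E`). The potential `2 * |w| - 1` pays for it, since `2 * (p + q) - 1 = (2 * p - 1) +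
  -- (2 * q - 1) + 1`.
  set K := N + 1 + m * E with hKdef
  have hK : ∀ ℓ A n w, w ≠ [] → w.length ≤ ℓ → g.Gen n [.nonterminal A] w →
      ∃ n' ≤ K * (2 * w.length - 1), g.Gen n' [.nonterminal A] w := by
    intro ℓ
    induction ℓ with
    | zero => exact fun A n w hw hl => absurd (List.length_eq_zero_iff.1 (by omega)) hw
    | succ ℓ ihℓ =>
      intro A₀ n₀ w hw hl h₀
      obtain ⟨r₀, hr₀, rfl, -⟩ := exists_rule_of_gen h₀
      have hlen : 1 ≤ w.length := List.length_pos_iff.2 hw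
      have hKw : K ≤ K * (2 * w.length - 1) := Nat.le_mul_of_pos_right K (by omega)
      -- Descend as long as a single nonterminal yields all of `w`, by induction on the steps left.
      -- Only the existence of some chain from the root to `A` is remembered; its cost is replaced
      -- by `N` at the end.
      have key : ∀ n A, (∃ c, g.Chain c r₀.input A) → g.Gen n [.nonterminal A] w →
          ∃ n' ≤ K * (2 * w.length - 1), g.Gen n' [.nonterminal r₀.input] w := by
        intro n
        induction n using Nat.strong_induction_on with
        | _ n ihn =>
        intro A hA h
        obtain ⟨r, hr, rfl, n', rfl, h'⟩ := exists_rule_of_gen h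
        have hmE : r.output.length * E ≤ m * E := Nat.mul_le_mul_right E (hm r hr)
        have hchain := hN r₀ hr₀ r hr hA
        have hfin : ∀ k, g.Gen k r.output w → N + 1 + k ≤ K * (2 * w.length - 1) →
            ∃ n' ≤ K * (2 * w.length - 1), g.Gen n' [.nonterminal r₀.input] w := by
          intro k hk hle
          obtain ⟨n', hn', hg⟩ := hchain (k + 1) w (.rule r hr (by simpa using hk))
          exact ⟨n', by omega, hg⟩
        rcases h'.single_or_split hw with ⟨u, X, v, k₁, k₂, k₃, hs, rfl, g1, g2, g3⟩ |
          ⟨u, v, k₁, k₂, w₁, w₂, hs, rfl, e1, e2, g1, g2⟩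
        -- The neighbours of `X` derive the empty word, so `exists_gen_le_of_forall` applies with `K
        -- = 0` and `ℓ = 0`, and only `E` counts.
        · have hvoid : ∀ A n w, w ≠ [] → w.length ≤ 0 → g.Gen n [.nonterminal A] w →
              ∃ n' ≤ 0 * (2 * w.length - 1), g.Gen n' [.nonterminal A] w :=
            fun A n w hw hl => absurd (List.length_eq_zero_iff.1 (by omega)) hw
          obtain ⟨j₁, hj₁, f1⟩ := exists_gen_le_of_forall hE hvoid (by simp) g1
          obtain ⟨j₃, hj₃, f3⟩ := exists_gen_le_of_forall hE hvoid (by simp) g3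
          simp only [zero_mul, add_zero] at hj₁ hj₃
          have hsl : r.output.length * E = u.length * E + v.length * E + E := by
            rw [hs, List.length_append, List.length_cons]; ring
          cases X with
          | terminal a =>
            cases g2 with
            | terminal a g2 =>
              cases g2
              refine hfin (j₁ + (0 + j₃)) ?_ (by omega)
              rw [hs]
              exact f1.append ((Gen.terminal a .nil).append f3)
          | nonterminal B =>
            refine ihn k₂ (by omega) B ?_ g2
            obtain ⟨c, hc⟩ := hA
            -- The chain is prolonged to `B` by the rule `r` (one step) and the erasing of `u` and
            -- `v`.
            refine ⟨c + (1 + j₁ + j₃), fun n w' h' => ?_⟩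
            have f4 : g.Gen (j₁ + (n + j₃)) (r.output ++ []) w' := by
              rw [List.append_nil, hs]
              simpa using f1.append (h'.append f3)
            obtain ⟨n', hn', hg⟩ := hc _ _ (.rule r hr f4)
            exact ⟨n', by omega, hg⟩
        · have hl1 : 1 ≤ w₁.length := List.length_pos_iff.2 e1
          have hl2 : 1 ≤ w₂.length := List.length_pos_iff.2 e2
          rw [List.length_append] at hl
          obtain ⟨j₁, hj₁, f1⟩ := exists_gen_le_of_forall hE ihℓ (by omega) g1
          obtain ⟨j₂, hj₂, f2⟩ := exists_gen_le_of_forall hE ihℓ (by omega) g2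
          have hsl : r.output.length * E = u.length * E + v.length * E := by
            rw [hs, List.length_append]; ring
          refine hfin (j₁ + j₂) (by rw [hs]; exact f1.append f2) ?_
          have : K * (2 * (w₁ ++ w₂).length - 1) =
              K * (2 * w₁.length - 1) + K * (2 * w₂.length - 1) + K := by
            rw [← mul_add, ← Nat.mul_succ, List.length_append]
            congr 1
            omega
          omega
      exact key n₀ r₀.input ⟨0, fun n w h => ⟨n, le_rfl, h⟩⟩ h₀
  refine ⟨K * 2, E, fun A n w h => ?_⟩
  by_cases hw : w = []
  · subst hw
    obtain ⟨n', hn', hg⟩ := hE A n h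
    exact ⟨n', by omega, hg⟩
  · obtain ⟨n', hn', hg⟩ := hK _ A n w hw le_rfl h
    have : K * (2 * w.length - 1) ≤ K * 2 * w.length := by
      rw [mul_assoc]
      exact Nat.mul_le_mul_left K (by omega)
    exact ⟨n', by omega, hg⟩

end ContextFreeGrammar

/-! ### The pushdown automaton of a context-free grammar -/

namespace ContextFreeGrammar

/-- The states of the pushdown automaton of a grammar. -/
inductive PDAState : Type
  | start : PDAState
  | run : PDAState
  | accept : PDAState

instance : Finite PDAState :=
  Finite.of_injective (fun q : PDAState => (match q with | .start => 0 | .run => 1 | .accept => 2 :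
    Fin 3)) (by rintro (_ | _ | _) (_ | _ | _) h <;> first | rfl | cases h)

variable {T : Type} (g : ContextFreeGrammar T)

/-- The terminals, and the nonterminals to which some rule applies. -/
def liveSymbols : Set (Symbol T g.NT) :=
  Set.range Symbol.terminal ∪ (fun r : ContextFreeRule T g.NT => Symbol.nonterminal r.input) '' ↑g.rules

theorem finite_liveSymbols [Finite T] : g.liveSymbols.Finite :=
  (Set.finite_range _).union (g.rules.finite_toSet.image _)

/-- The stack alphabet of the pushdown automaton of a grammar: `none` is the bottom marker, and
`some none` stands for all nonterminals without rules. -/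
abbrev StackSym : Type := Option (Option g.liveSymbols)

open Classical in
/-- The stack symbol for a symbol of the grammar. -/
noncomputable def stackSym (X : Symbol T g.NT) : g.StackSym :=
  if h : X ∈ g.liveSymbols then some (some ⟨X, h⟩) else some none

variable {g}

theorem stackSym_ne_none {X : Symbol T g.NT} : g.stackSym X ≠ none := by
  unfold stackSym
  split <;> simp

/-- The coding is injective only on live symbols, because all nonterminals without rules share one
code to keep the stack alphabet finite. This suffices: grammar moves compare the top only with codes
of live symbols. -/
theorem eq_of_stackSym_eq {X Y : Symbol T g.NT} (hY : Y ∈ g.liveSymbols)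
    (h : g.stackSym X = g.stackSym Y) : X = Y := by
  unfold stackSym at h
  rw [dif_pos hY] at h
  split at h
  · simpa using h
  · simp at h

variable (g)

/-- The transition function of the pushdown automaton of a grammar. -/
def pdaTrans : PDAState → Option (InputSym T) → g.StackSym →
    Set (PDAState × List g.StackSym × Option Empty)
  | .start, some .cent, none => {(.run, [g.stackSym (.nonterminal g.initial), none], none)}
  | .run, none, Z => {m | ∃ r ∈ g.rules, Z = g.stackSym (.nonterminal r.input) ∧
      m = (.run, r.output.map g.stackSym, none)}
  | .run, some (.letter a), Z => {m | Z = g.stackSym (.terminal a) ∧ m = (.run, [], none)}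
  | .run, some .dollar, none => {(.accept, [], none)}
  | _, _, _ => ∅

theorem finite_pdaTrans (q : PDAState) (s : Option (InputSym T)) (Z : g.StackSym) :
    (g.pdaTrans q s Z).Finite := by
  unfold pdaTrans
  split
  · exact Set.finite_singleton _
  · refine (g.rules.finite_toSet.image
      fun r => (PDAState.run, r.output.map g.stackSym, (none : Option Empty))).subset ?_
    rintro m ⟨r, hr, -, rfl⟩
    exact ⟨r, hr, rfl⟩
  · refine (Set.finite_singleton (PDAState.run, [], none)).subset ?_
    rintro m ⟨-, rfl⟩
    rfl
  · exact Set.finite_singleton _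
  · exact Set.finite_empty

/-- The pushdown automaton that follows the leftmost derivations of a grammar. -/
noncomputable def toNPDA [Finite T] : NPDA T (Option Empty) where
  Q := PDAState
  Θ := g.StackSym
  finite_Q := inferInstance
  finite_Θ := by
    have := g.finite_liveSymbols.to_subtype
    infer_instance
  δ := g.pdaTrans
  finite_δ := g.finite_pdaTrans
  q₀ := .start
  Z₀ := none
  acc := {.accept}
  rej := ∅
  disjoint_acc_rej := Set.disjoint_empty _

variable {g} [Finite T]

/-- The configuration with the sentential form `s` on the stack and the input `w` ahead. -/
noncomputable def runConfig (s : List (Symbol T g.NT)) (w : List T) : g.toNPDA.Config :=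
  ⟨PDAState.run, w.map .letter ++ [.dollar], s.map g.stackSym ++ [none], []⟩

theorem runConfig_append (v s : List (Symbol T g.NT)) (w : List T) :
    runConfig (v ++ s) w = ⟨PDAState.run, w.map .letter ++ [.dollar],
      (v.map g.stackSym ++ (s.map g.stackSym ++ [none]) : List g.StackSym), []⟩ := by
  have h : (v ++ s).map g.stackSym ++ [none] =
      v.map g.stackSym ++ (s.map g.stackSym ++ [none]) := by
    rw [List.map_append, List.append_assoc]
  exact congrArg (fun st : List g.StackSym => (⟨PDAState.run,
    w.map InputSym.letter ++ [InputSym.dollar], st, []⟩ : g.toNPDA.Config)) h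

theorem run_notMem_halt : PDAState.run ∉ g.toNPDA.halt := by
  rintro (h | h) <;> cases h

theorem start_notMem_halt : PDAState.start ∉ g.toNPDA.halt := by
  rintro (h | h) <;> cases h

/-- One move for each rule, one for each terminal, and a last one that reads `$`. -/
theorem Gen.exists_reachesIn {n : ℕ} {s : List (Symbol T g.NT)} {w : List T} (h : g.Gen n s w)
    {t : ℕ} {c : g.toNPDA.Config} (hc : ReachesIn g.toNPDA.Step t c (runConfig s w)) :
    ∃ d, ReachesIn g.toNPDA.Step (t + n + w.length + 1) c d ∧ d.state ∈ g.toNPDA.acc := by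
  induction h generalizing t with
  | nil =>
    exact ⟨⟨PDAState.accept, [], [], []⟩, hc.tail (NPDA.Step.read (N := g.toNPDA) (v := [])
      (o := none) (st := []) (out := []) run_notMem_halt rfl), rfl⟩
  | @terminal n s w a h ih =>
    have hstep : g.toNPDA.Step (runConfig (.terminal a :: s) (a :: w)) (runConfig s w) :=
      NPDA.Step.read (N := g.toNPDA) (v := []) (o := none) (out := []) run_notMem_halt ⟨rfl, rfl⟩
    obtain ⟨d, hd, hacc⟩ := ih (hc.tail hstep)
    refine ⟨d, ?_, hacc⟩
    convert hd using 1
    simp only [List.length_cons]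
    omega
  | @rule n s w r hr h ih =>
    have hstep : g.toNPDA.Step (runConfig (.nonterminal r.input :: s) w)
        (runConfig (r.output ++ s) w) := by
      rw [runConfig_append]
      exact NPDA.Step.lambda (N := g.toNPDA) (u := w.map .letter ++ [.dollar])
        (st := s.map g.stackSym ++ [none]) (o := none) (out := []) run_notMem_halt
        (show (_, r.output.map g.stackSym, none) ∈
          g.pdaTrans .run none (g.stackSym (.nonterminal r.input)) from ⟨r, hr, rfl, rfl⟩)
    obtain ⟨d, hd, hacc⟩ := ih (hc.tail hstep)
    refine ⟨d, ?_, hacc⟩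
    convert hd using 1
    omega

theorem step_start {w : List T} {d : g.toNPDA.Config} :
    g.toNPDA.Step (g.toNPDA.start w) d ↔ d = runConfig [.nonterminal g.initial] w := by
  constructor
  · intro h
    generalize hc : g.toNPDA.start w = c at h
    cases h with
    | @read q p s u Z v st o out h1 h2 =>
      cases hc
      cases h2
      rfl
    | @lambda q p u Z v st o out h1 h2 =>
      cases hc
      cases h2
  · rintro rfl
    exact NPDA.Step.read (N := g.toNPDA) (v := [_, none]) (o := none) (st := []) (out := [])
      start_notMem_halt rfl

/-- In the first case `d` is left open: the move is the accepting one on `$`, and then the empty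
derivation is all that is needed. -/
theorem step_runConfig {s : List (Symbol T g.NT)} {w : List T} {d : g.toNPDA.Config}
    (h : g.toNPDA.Step (runConfig s w) d) :
    (s = [] ∧ w = []) ∨
    (∃ a s' w', s = .terminal a :: s' ∧ w = a :: w' ∧ d = runConfig s' w') ∨
    (∃ r ∈ g.rules, ∃ s', s = .nonterminal r.input :: s' ∧ d = runConfig (r.output ++ s') w) := by
  generalize hc : runConfig s w = c at h
  cases h with
  | @read q p x u Z v st o out h1 h2 =>
    cases w with
    | nil =>
      cases s with
      | nil => exact .inl ⟨rfl, rfl⟩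
      | cons X s =>
        cases hc
        -- No transition reads `$` while a symbol lies above the bottom marker.
        exfalso
        generalize hZ : g.stackSym X = Z at h2
        cases Z with
        | none => exact stackSym_ne_none hZ
        | some Z => exact h2
    | cons a w =>
      cases s with
      | nil =>
        cases hc
        exact absurd h2.1.symm stackSym_ne_none
      | cons X s =>
        cases hc
        obtain ⟨hX, hm⟩ := h2
        cases hm
        cases eq_of_stackSym_eq (Or.inl ⟨a, rfl⟩) hX
        exact .inr (.inl ⟨a, s, w, rfl, rfl, rfl⟩)
  | @lambda q p u Z v st o out h1 h2 =>
    cases s with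
    | nil =>
      cases hc
      obtain ⟨r, hr, hZ, -⟩ := h2
      exact absurd hZ.symm stackSym_ne_none
    | cons X s =>
      cases hc
      obtain ⟨r, hr, hX, hm⟩ := h2
      cases hm
      cases eq_of_stackSym_eq (Or.inr ⟨r, hr, rfl⟩) hX
      exact .inr (.inr ⟨r, hr, s, rfl, (runConfig_append _ _ _).symm⟩)

theorem exists_gen_of_reachesIn {t : ℕ} {s : List (Symbol T g.NT)} {w : List T}
    {d : g.toNPDA.Config} (h : ReachesIn g.toNPDA.Step t (runConfig s w) d)
    (hd : d.state ∈ g.toNPDA.acc) : ∃ n, g.Gen n s w := by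
  induction t generalizing s w with
  | zero =>
    cases h
    cases hd
  | succ t ih =>
    obtain ⟨c, hstep, hc⟩ := h.head_cases
    obtain ⟨rfl, rfl⟩ | ⟨a, s, w, rfl, rfl, rfl⟩ | ⟨r, hr, s, rfl, rfl⟩ := step_runConfig hstep
    · exact ⟨0, .nil⟩
    · obtain ⟨n, hn⟩ := ih hc
      exact ⟨n, .terminal a hn⟩
    · obtain ⟨n, hn⟩ := ih hc
      exact ⟨n + 1, .rule r hr hn⟩

end ContextFreeGrammar

theorem Language.IsContextFree.decidesInLinearSpace {T : Type} [Finite T] {L : Language T}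
    (hL : L.IsContextFree) : DecidesInLinearSpace L := by
  obtain ⟨g, rfl⟩ := hL
  obtain ⟨a, b, hab⟩ := g.exists_short_gen
  -- A derivation of `n'` steps takes `n' + x.length` moves, and the endmarkers take two more; hence
  -- `a + 1` and `b + 2`.
  refine .of_oracleNPDA g.toNPDA.toOracle decidesInLinearSpace_empty (a + 1) (b + 2) ?_ ?_
  · rintro x ⟨c', hc', hacc⟩
    obtain ⟨t, ht⟩ := exists_reachesIn hc'
    obtain ⟨c, rfl, hc⟩ := NPDA.exists_reachesIn_of_toOracle (c := g.toNPDA.start x) ht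
    rw [NPDA.state_toOracle_mem_acc] at hacc
    cases t with
    | zero =>
      cases hc
      cases hacc
    | succ t =>
      obtain ⟨d, hd, hdc⟩ := hc.head_cases
      rw [ContextFreeGrammar.step_start] at hd
      subst hd
      exact ContextFreeGrammar.mem_language_iff_gen.2
        (ContextFreeGrammar.exists_gen_of_reachesIn hdc hacc)
  · intro x hx
    obtain ⟨n, hn⟩ := ContextFreeGrammar.mem_language_iff_gen.1 hx
    obtain ⟨n', hn', hgen⟩ := hab _ _ _ hn
    obtain ⟨d, hd, hacc⟩ := hgen.exists_reachesIn
      ((ReachesIn.refl _).tail (ContextFreeGrammar.step_start.2 rfl))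
    refine ⟨_, ?_, d.toOracle, NPDA.reachesIn_toOracle hd, NPDA.state_toOracle_mem_acc.2 hacc⟩
    rw [Nat.add_mul]
    omega

/-! ### The classes of the hierarchy -/

/-- The complement of the oracle lies one level lower, and a decider for it yields one for the
oracle. Linear time of `M` makes all accepting paths short enough for the search. -/
theorem decidesInLinearSpace_of_mem_sigmaCFL {k : ℕ} {α : Type} [Finite α] {L : Language α}
    (hL : L ∈ SigmaCFL (k + 1) α) : DecidesInLinearSpace L := by
  induction k generalizing α with
  | zero => exact Language.IsContextFree.decidesInLinearSpace hL
  | succ k ih =>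
    obtain ⟨β, _, A, hA, M, ⟨a, b, hM⟩, hLM⟩ := hL
    have hA' : DecidesInLinearSpace A := by simpa using (ih hA).compl
    refine .of_oracleNPDA M hA' a b (fun x => (hLM x).2) fun x hx => ?_
    obtain ⟨c, hc, hacc⟩ := (hLM x).1 hx
    obtain ⟨t, ht⟩ := exists_reachesIn hc
    exact ⟨t, (hM A x t c ht).1, c, ht, hacc⟩

theorem mainTheorem3 (k : ℕ) (hk : 1 ≤ k) (α γ : Type) [Finite α] [Finite γ]
    (f : List α → Set (List γ)) (hf : f ∈ SigmaCFLSVt k α γ) :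
    ∃ M : MultiTapeTM α γ, M.LinearSpace ∧ M.Computes f := by
  obtain ⟨⟨hf, hsv⟩, htot⟩ := hf
  match k, hk, hf with
  | 1, _, ⟨N, ⟨a, b, hN⟩, hfN⟩ =>
    refine exists_multiTapeTM_of_oracleNPDA N.toOracle decidesInLinearSpace_empty a b
      (fun x => (hfN x).trans (N.outcomes_toOracle x).symm) hsv htot fun x t c h => ?_
    obtain ⟨d, -, hd⟩ := NPDA.exists_reachesIn_of_toOracle (c := N.start x) h
    exact (hN x t d hd).1
  | k + 2, _, ⟨β, _, A, hA, M, ⟨a, b, hM⟩, hfM⟩ =>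
    have hA' : DecidesInLinearSpace A := by
      simpa using (decidesInLinearSpace_of_mem_sigmaCFL hA).compl
    exact exists_multiTapeTM_of_oracleNPDA M hA' a b hfM hsv htot
      fun x t c h => (hM A x t c h).1
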